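/- For a squarefree integer $c\neq 1$ let $\Delta(c)$ denote the discriminant of the quadratic field $\mathbf{Q}(\sqrt c)$. Let $a,b\neq 1$ be squarefree integers (possibly equal, possibly negative), and let $(x,y,z)\in\mathbf{Q}^3$ be a non-zero solution of $x^2-ay^2-bz^2=0$. Put $K=\mathbf{Q}(\sqrt{ab})$, $E=\mathbf{Q}(\sqrt a,\sqrt b)$, $\beta=x+y\sqrt a$ and $F=F(x,y,z)=E(\sqrt\beta)$, and for $t\in\mathbf{Q}^*$ let $F_t=F(tx,ty,tz)=E(\sqrt{t\beta})$ be the quadratic twist of $F$ by $t$. (It is well known that $F_t$ is a cyclic extension of $K$ of degree $4$.) An extension of number fields is called unramified over a rational prime $p$ if all primes lying over $p$ are unramified in it. Let $p$ be a prime number with $p\nmid\Delta(b)$. 1. If $p\nmid\Delta(a)$, then $\mathbf{Q}\subset F_t$ is unramified over $p$ for a unique value $t\in\{1,p\}$ if $p$ is odd, and for a unique value $t\in\{\pm1,\pm2\}$ if $p=2$. 2. If $p$ is odd and $p\mid\Delta(a)$, then $K\subset F$ is unramified over $p$. 3. If $\Delta(a)$ is even and $\Delta(b)\equiv1\bmod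 8$, then $K\subset F_t$ is unramified over $2$ for exactly two values $t\in\{\pm1,\pm2\}$. 4. If $\Delta(a)$ is even and $\Delta(b)\equiv5\bmod 8$, then $K\subset F_t$ is ramified over $2$ for every $t\in\mathbf{Q}^*$, and $\Delta(a)\equiv4\bmod 8$. -/

import Mathlib

open NumberField

namespace RedeiField

/-- The field `ℚ(√c) ⊆ ℂ`. -/
noncomputable def sqrtField (c : ℤ) : IntermediateField ℚ ℂ :=
  IntermediateField.adjoin ℚ {w : ℂ | w ^ 2 = (c : ℂ)}

theorem finite_sqrt (c : ℤ) : {w : ℂ | w ^ 2 = (c : ℂ)}.Finite := by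
  obtain ⟨s, hs⟩ : ∃ s : ℂ, (c : ℂ) = s ^ 2 := (IsAlgClosed.exists_pow_nat_eq (c : ℂ) two_pos).imp fun _ h => h.symm
  refine (Set.toFinite {s, -s}).subset fun w hw => ?_
  exact sq_eq_sq_iff_eq_or_eq_neg.mp (hw.trans hs)

instance numberField_sqrtField (c : ℤ) : NumberField (sqrtField c) := by
  have : Finite {w : ℂ | w ^ 2 = (c : ℂ)} := finite_sqrt c
  have : FiniteDimensional ℚ (sqrtField c) := by
    refine IntermediateField.finiteDimensional_adjoin fun w hw => ?_
    refine IsIntegral.of_pow (n := 2) (by norm_num) ?_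
    rw [hw]
    exact_mod_cast isIntegral_algebraMap (R := ℚ) (A := ℂ) (x := (c : ℚ))
  exact ⟨⟩

/-- `Δ(c)`, the discriminant of the field `ℚ(√c)`. -/
noncomputable def Δ (c : ℤ) : ℤ := NumberField.discr (sqrtField c)

/-- The field `E = ℚ(√a, √b)`. -/
noncomputable def biquadField (a b : ℤ) : IntermediateField ℚ ℂ :=
  sqrtField a ⊔ sqrtField b

/-- The field `F(x, y, z) = E(√β)` with `E = ℚ(√a, √b)` and `β = x + y√a`; here `α` is the chosen
square root of `a`. (The coordinate `z` is determined up to sign by `x` and `y`.) -/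
noncomputable def extField (a b : ℤ) (α : ℂ) (x y : ℚ) : IntermediateField ℚ ℂ :=
  biquadField a b ⊔ IntermediateField.adjoin ℚ {w : ℂ | w ^ 2 = (x : ℂ) + (y : ℂ) * α}

/-- The quadratic twist `F_t = F(tx, ty, tz) = E(√(tβ))` of `F(x, y, z)`. -/
noncomputable def twist (a b : ℤ) (α : ℂ) (x y t : ℚ) : IntermediateField ℚ ℂ :=
  extField a b α (t * x) (t * y)

theorem sqrtField_mul_le_extField (a b : ℤ) (α : ℂ) (x y : ℚ) :
    sqrtField (a * b) ≤ extField a b α x y := by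
  refine le_trans ?_ (le_sup_left : biquadField a b ≤ _)
  refine IntermediateField.adjoin_le_iff.mpr fun w hw => ?_
  obtain ⟨s, hs⟩ : ∃ s : ℂ, (a : ℂ) = s ^ 2 := (IsAlgClosed.exists_pow_nat_eq (a : ℂ) two_pos).imp fun _ h => h.symm
  obtain ⟨r, hr⟩ : ∃ r : ℂ, (b : ℂ) = r ^ 2 := (IsAlgClosed.exists_pow_nat_eq (b : ℂ) two_pos).imp fun _ h => h.symm
  have h1 : s ∈ biquadField a b := (le_sup_left : sqrtField a ≤ _)
    (IntermediateField.subset_adjoin ℚ _ hs.symm)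
  have h2 : r ∈ biquadField a b := (le_sup_right : sqrtField b ≤ _)
    (IntermediateField.subset_adjoin ℚ _ hr.symm)
  have h : w ^ 2 = (s * r) ^ 2 := by
    rw [mul_pow, ← hs, ← hr]
    simpa using hw
  rcases sq_eq_sq_iff_eq_or_eq_neg.mp h with h | h
  · rw [h]
    exact mul_mem h1 h2
  · rw [h]
    exact neg_mem (mul_mem h1 h2)

/-- The field `F(x, y, z)` regarded as an extension field of `K = ℚ(√(ab))`. -/
noncomputable def extFieldOverK (a b : ℤ) (α : ℂ) (x y : ℚ) :
    IntermediateField (sqrtField (a * b)) ℂ :=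
  IntermediateField.extendScalars (sqrtField_mul_le_extField a b α x y)

/-- The twist `F_t` regarded as an extension field of `K = ℚ(√(ab))`. -/
noncomputable def twistOverK (a b : ℤ) (α : ℂ) (x y t : ℚ) :
    IntermediateField (sqrtField (a * b)) ℂ :=
  extFieldOverK a b α (t * x) (t * y)

/-- The extension of number fields `K ⊆ L` is unramified over the rational prime `p`: every prime
of `K` dividing `p` is unramified in `L`. -/
def UnramifiedOver (K L : Type*) [Field K] [Field L] [Algebra K L] (p : ℕ) : Prop :=
  ∀ 𝔭 : Ideal (𝓞 K), 𝔭.IsPrime → (p : 𝓞 K) ∈ 𝔭 → Algebra.IsUnramifiedIn (𝓞 L) 𝔭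

end RedeiField

/-! A Galois extension L/K is unramified over p exactly when, for every prime P of L above p, only
the identity of Gal(L/K) acts trivially modulo P. Since F_t is generated by A = √a, B = √b and R =
√(tβ), the question is which of these signs inertia can change.

Signs that inertia preserves: for odd p, square roots of fixed P-units (`IsInert.map_eq_of_sq_eq`);
for p = 2, square roots of fixed elements s² + 4e with s a fixed P-unit
(`IsInert.map_eq_of_sq_eq_sq_add`). A sign that inertia does change: √c for an integer c whose
quadratic field ramifies (`exists_inert_neg_of_sq_eq`).

Two identities move β to a place where these criteria apply: ββ' = bz², with β' the conjugate of β,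
and 2(x + y√a)(x + z√b) = (x + y√a + z√b)² on the conic (`sq_div_eq`). After rescaling to
p-primitive integers (X, Y, Z), they give the unramified twists in parts 1 and 2. If b ≡ 1 mod 8,
then b is a 2-adic square, so X + Z√b may be replaced by an integer X + Zw with w² close to b. Its
class modulo the unramified 2-adic square classes, for which ±1, ±2 are representatives, selects a
twist. As √a lies in F, the class multiplied by a selects a second one, which is the count in part 3
(`IsInert.map_eq_of_split`).

For the converse in parts 1 and 3, if F_t and F_t' are both unramified, their compositum contains
√(tt'), which inertia must then fix (`exists_sqrt_fixed_by_inert`); this restricts tt'.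

In part 4, congruences modulo 8 force a ≡ 3 mod 4. Inertia then moves √a and Frobenius moves √b. The
product of an inertia element and its Frobenius conjugate fixes √a and √b but not F, so it is a
non-trivial inertia element over K, whatever t is (`not_unramifiedOver_two_of_inert`). -/

namespace RedeiField

/-! ### Unramifiedness as triviality of inertia. -/

section Inertia

/-- `σ` acts trivially on the residue ring `𝓞 L ⧸ P`. -/
def IsInert {L : Type*} [Field L] (P : Ideal (𝓞 L)) (σ : L →+* L) : Prop :=
  ∀ x : 𝓞 L, ∃ y ∈ P, algebraMap (𝓞 L) L y = σ (algebraMap (𝓞 L) L x) - algebraMap (𝓞 L) L x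

variable {K L : Type*} [Field K] [NumberField K] [Field L] [NumberField L] [Algebra K L]

omit [NumberField K] [NumberField L] in
theorem isInert_iff_mem_inertia (P : Ideal (𝓞 L)) (σ : L ≃ₐ[K] L) :
    IsInert P (σ : L →+* L) ↔ σ ∈ P.inertia (L ≃ₐ[K] L) := by
  rw [AddSubgroup.mem_inertia]
  constructor
  · intro h x
    obtain ⟨y, hy, e⟩ := h x
    have : σ • x - x = y := RingOfIntegers.ext (e.symm)
    rw [this]; exact hy
  · intro h x
    exact ⟨σ • x - x, h x, rfl⟩

theorem card_inertia_eq_ramificationIdx [IsGalois K L] (P : Ideal (𝓞 L)) [P.IsPrime] (hP : P ≠ ⊥) :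
    Nat.card (P.inertia (L ≃ₐ[K] L)) = P.ramificationIdx (𝓞 K) := by
  have h0 : P.under (𝓞 K) ≠ ⊥ := Ideal.IsIntegral.comap_ne_bot (𝓞 K) hP
  have : (P.under (𝓞 K)).IsPrime := inferInstance
  have : (P.under (𝓞 K)).IsMaximal := this.isMaximal h0
  have : Finite (𝓞 K ⧸ P.under (𝓞 K)) := Ring.HasFiniteQuotients.finiteQuotient h0
  rw [Ideal.card_inertia_eq_ramificationIdxIn (G := (L ≃ₐ[K] L)) (P.under (𝓞 K)) P,
    Ideal.ramificationIdxIn_eq_ramificationIdx (P.under (𝓞 K)) P (L ≃ₐ[K] L)]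

theorem isUnramifiedAt_iff_inertia_eq_bot [IsGalois K L] (P : Ideal (𝓞 L)) [P.IsPrime] (hP : P ≠ ⊥) :
    Algebra.IsUnramifiedAt (𝓞 K) P ↔ P.inertia (L ≃ₐ[K] L) = ⊥ := by
  have h0 : P.under (𝓞 K) ≠ ⊥ := Ideal.IsIntegral.comap_ne_bot (𝓞 K) hP
  have : (P.under (𝓞 K)).IsPrime := inferInstance
  have : (P.under (𝓞 K)).IsMaximal := this.isMaximal h0
  have : Finite (𝓞 K ⧸ P.under (𝓞 K)) := Ring.HasFiniteQuotients.finiteQuotient h0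
  rw [← Ideal.ramificationIdx_eq_one_iff, ← card_inertia_eq_ramificationIdx P hP,
    Subgroup.card_eq_one]

theorem ne_bot_of_natCast_mem {p : ℕ} (hp : p.Prime) {P : Ideal (𝓞 L)} (h : (p : 𝓞 L) ∈ P) :
    P ≠ ⊥ := by
  rintro rfl
  exact hp.ne_zero (by exact_mod_cast (Ideal.mem_bot.mp h))

theorem unramifiedOver_of_inert [IsGalois K L] {p : ℕ} (hp : p.Prime)
    (h : ∀ P : Ideal (𝓞 L), P.IsPrime → (p : 𝓞 L) ∈ P → ∀ σ : L ≃ₐ[K] L,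
      IsInert P (σ : L →+* L) → σ = 1) : UnramifiedOver K L p := by
  intro 𝔭 _ hp𝔭 P hP hPo
  have hpP : (p : 𝓞 L) ∈ P := by
    have := (Ideal.mem_of_liesOver P 𝔭 (p : 𝓞 K)).mp hp𝔭
    simpa using this
  rw [isUnramifiedAt_iff_inertia_eq_bot P (ne_bot_of_natCast_mem hp hpP), Subgroup.eq_bot_iff_forall]
  exact fun σ hσ => h P hP hpP σ ((isInert_iff_mem_inertia P σ).mpr hσ)

theorem UnramifiedOver.eq_one_of_inert [IsGalois K L] {p : ℕ} (hp : p.Prime)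
    (h : UnramifiedOver K L p) {P : Ideal (𝓞 L)} [P.IsPrime] (hpP : (p : 𝓞 L) ∈ P)
    {σ : L ≃ₐ[K] L} (hσ : IsInert P (σ : L →+* L)) : σ = 1 := by
  have h1 := h (P.under (𝓞 K)) inferInstance (by simpa using hpP) P inferInstance ⟨rfl⟩
  rw [isUnramifiedAt_iff_inertia_eq_bot P (ne_bot_of_natCast_mem hp hpP)] at h1
  simpa [h1] using (isInert_iff_mem_inertia P σ).mp hσ

/-- An automorphism of a larger field in the inertia group acts trivially on an unramified
normal subextension. -/
theorem UnramifiedOver.map_eq_of_inert [IsGalois K L] {p : ℕ} (hp : p.Prime)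
    (h : UnramifiedOver K L p) {M : Type*} [Field M] [NumberField M] [Algebra K M]
    (i : L →ₐ[K] M) {P : Ideal (𝓞 M)} [P.IsPrime] (hpP : (p : 𝓞 M) ∈ P)
    {σ : M ≃ₐ[K] M} (hσ : IsInert P (σ : M →+* M)) (x : L) : σ (i x) = i x := by
  let : Algebra L M := i.toRingHom.toAlgebra
  have : IsScalarTower K L M := IsScalarTower.of_algebraMap_eq fun r => (i.commutes r).symm
  let τ : L ≃ₐ[K] L := σ.restrictNormal L
  have hτ (x : L) : i (τ x) = σ (i x) := AlgEquiv.restrictNormal_commutes σ L x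
  let Q : Ideal (𝓞 L) := P.under (𝓞 L)
  have hQ : IsInert Q (τ : L →+* L) := by
    rw [isInert_iff_mem_inertia, AddSubgroup.mem_inertia]
    intro x
    have h2 := (isInert_iff_mem_inertia P σ).mp hσ
    rw [AddSubgroup.mem_inertia] at h2
    have h3 := h2 (algebraMap (𝓞 L) (𝓞 M) x)
    change algebraMap (𝓞 L) (𝓞 M) (τ • x - x) ∈ P
    have h4 : algebraMap (𝓞 L) (𝓞 M) (τ • x - x) =
        σ • (algebraMap (𝓞 L) (𝓞 M)) x - (algebraMap (𝓞 L) (𝓞 M)) x := by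
      apply RingOfIntegers.ext
      change i (τ x - x) = σ (i x) - i x
      rw [map_sub, hτ]
    rw [h4]
    exact h3
  have : τ = 1 := h.eq_one_of_inert hp (P := Q) (by change algebraMap (𝓞 L) (𝓞 M) _ ∈ P; simpa using hpP) hQ
  rw [← hτ, this]; rfl

theorem intCast_mem_iff {p : ℕ} (hp : p.Prime) {P : Ideal (𝓞 L)} [hP : P.IsPrime]
    (hpP : (p : 𝓞 L) ∈ P) (n : ℤ) : (n : 𝓞 L) ∈ P ↔ (p : ℤ) ∣ n := by
  constructor
  · intro hn
    by_contra h
    have hc : IsCoprime (p : ℤ) n := (Nat.prime_iff_prime_int.mp hp).coprime_iff_not_dvd.mpr h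
    obtain ⟨u, v, huv⟩ := hc
    refine hP.ne_top ((Ideal.eq_top_iff_one P).mpr ?_)
    have : (1 : 𝓞 L) = u * p + v * n := by exact_mod_cast congrArg (Int.cast : ℤ → 𝓞 L) huv.symm
    rw [this]
    exact P.add_mem (P.mul_mem_left _ hpP) (P.mul_mem_left _ hn)
  · rintro ⟨m, rfl⟩
    push_cast
    exact P.mul_mem_right _ hpP

/-- If `π = m + s` satisfies `π ^ 2 = p * u` with `u` prime to `P`, then `ℚ(s)` is ramified at `P`,
so that the inertia group acts non-trivially on it. -/
theorem exists_inert_neg_of_sq_eq {M : Type*} [Field M] [NumberField M] [IsGalois ℚ M] {p : ℕ}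
    (hp : p.Prime) {P : Ideal (𝓞 M)} [hP : P.IsPrime] (hpP : (p : 𝓞 M) ∈ P) {s : M} {c : ℚ}
    (hs : s ^ 2 = c) {π u : 𝓞 M} {m : ℤ} (hπ : algebraMap (𝓞 M) M π = m + s) (hu : u ∉ P)
    (hπu : π ^ 2 = p * u) : ∃ σ : M ≃ₐ[ℚ] M, IsInert P (σ : M →+* M) ∧ σ s = -s := by
  by_contra! hcon
  have hfix (σ : M ≃ₐ[ℚ] M) (hσ : IsInert P (σ : M →+* M)) : σ s = s := by
    have : σ s ^ 2 = s ^ 2 := by rw [← map_pow, hs, map_ratCast]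
    exact (sq_eq_sq_iff_eq_or_eq_neg.mp this).resolve_right (hcon σ hσ)
  let E := IntermediateField.adjoin ℚ {s}
  let Q : Ideal (𝓞 E) := P.under (𝓞 E)
  have hPbot := ne_bot_of_natCast_mem hp hpP
  have hpQ : (p : 𝓞 E) ∈ Q := by change algebraMap (𝓞 E) (𝓞 M) _ ∈ P; simpa using hpP
  have hQbot := ne_bot_of_natCast_mem hp hpQ
  have hfixE (σ : M ≃ₐ[ℚ] M) (hσ : IsInert P (σ : M →+* M)) (x : E) :
      σ (algebraMap E M x) = algebraMap E M x := by
    have : E ≤ IntermediateField.fixedField (Subgroup.zpowers σ) := by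
      refine IntermediateField.adjoin_le_iff.mpr ?_
      intro x hx
      rw [Set.mem_singleton_iff.mp hx, SetLike.mem_coe, IntermediateField.mem_fixedField_iff]
      intro f hf
      have : Subgroup.zpowers σ ≤ MulAction.stabilizer (M ≃ₐ[ℚ] M) s := by
        rw [Subgroup.zpowers_le]; exact hfix σ hσ
      exact this hf
    exact (IntermediateField.mem_fixedField_iff _ _).mp (this x.2) σ (Subgroup.mem_zpowers σ)
  -- If all of inertia fixes s, it already lies in Gal(M/E). So e(P/ℚ) ≤ e(P/E), and
  -- multiplicativity in the tower forces e(Q/ℚ) = 1.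
  have hcard : Nat.card (P.inertia (M ≃ₐ[ℚ] M)) ≤ Nat.card (P.inertia (M ≃ₐ[E] M)) := by
    refine Nat.card_le_card_of_injective
      (fun σ => ⟨AlgEquiv.ofRingEquiv (f := (σ.1 : M ≃+* M))
        (hfixE σ.1 ((isInert_iff_mem_inertia P σ.1).mpr σ.2)), fun x => σ.2 x⟩) ?_
    intro σ τ h
    ext x
    have := congrArg (fun f => f.1 x) h
    exact this
  rw [card_inertia_eq_ramificationIdx P hPbot, card_inertia_eq_ramificationIdx P hPbot,
    Ideal.ramificationIdx_tower (S := 𝓞 E) Q P] at hcard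
  have h1 : Q.ramificationIdx (𝓞 ℚ) = 1 := by
    have h2 := Ideal.ramificationIdx_pos Q (𝓞 ℚ)
    have h3 := Ideal.ramificationIdx_pos P (𝓞 E)
    nlinarith
  have h0 : Q.under (𝓞 ℚ) ≠ ⊥ := Ideal.IsIntegral.comap_ne_bot (𝓞 ℚ) hQbot
  rw [← Ideal.ramificationIdx'_eq_ramificationIdx (Q.under (𝓞 ℚ)) Q h0] at h1
  refine (Ideal.ramificationIdx'_ne_one_iff Ideal.map_comap_le).mpr ?_ h1
  have hsE : s ∈ E := IntermediateField.mem_adjoin_simple_self ℚ s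
  have hinj : Function.Injective (algebraMap (𝓞 E) (𝓞 M)) := FaithfulSMul.algebraMap_injective _ _
  have hint {x : 𝓞 M} (hx : algebraMap (𝓞 M) M x ∈ E) : ∃ y : 𝓞 E, algebraMap (𝓞 E) (𝓞 M) y = x := by
    refine ⟨⟨⟨algebraMap (𝓞 M) M x, hx⟩, ?_⟩, RingOfIntegers.ext rfl⟩
    have : IsIntegral ℤ (algebraMap E M ⟨algebraMap (𝓞 M) M x, hx⟩) := x.2
    exact (isIntegral_algebraMap_iff (algebraMap E M).injective).mp this
  have hπE : algebraMap (𝓞 M) M π ∈ E := by rw [hπ]; exact add_mem (intCast_mem E m) hsE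
  have huE : algebraMap (𝓞 M) M u ∈ E := by
    have h2 : algebraMap (𝓞 M) M π ^ 2 = p * algebraMap (𝓞 M) M u := by
      simpa using congrArg (algebraMap (𝓞 M) M) hπu
    have h3 : (p : M) ≠ 0 := by exact_mod_cast hp.ne_zero
    have h4 : algebraMap (𝓞 M) M u = π ^ 2 / p := by field_simp; rw [h2, mul_comm]
    rw [h4]
    exact div_mem (pow_mem hπE 2) (natCast_mem E p)
  obtain ⟨π', hπ'⟩ := hint hπE
  obtain ⟨u', hu'⟩ := hint huE
  have huQ : u' ∉ Q := fun h => hu (hu' ▸ h)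
  have heq : π' ^ 2 = p * u' := hinj (by simp [hπ', hu', hπu])
  have hπQ : π' ∈ Q := Ideal.IsPrime.mem_of_pow_mem inferInstance 2
    (heq ▸ Q.mul_mem_right _ hpQ)
  have hQmax : Q.IsMaximal := Ideal.IsPrime.isMaximal inferInstance hQbot
  -- The contradiction: with v inverse to u' modulo Q, p is π'²v plus p times an element of Q, and
  -- both terms lie in Q².
  have hpQ2 : (p : 𝓞 E) ∈ Q ^ 2 := by
    obtain ⟨v, q, hq, hv⟩ := hQmax.exists_inv huQ
    have h2 : (p : 𝓞 E) = π' ^ 2 * v + p * q := by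
      rw [heq]; linear_combination -(p : 𝓞 E) * hv
    rw [h2]
    refine add_mem (Ideal.mul_mem_right _ _ (Ideal.pow_mem_pow hπQ 2)) ?_
    rw [pow_two]
    exact Ideal.mul_mem_mul hpQ hq
  rw [Ideal.map_le_iff_le_comap]
  intro x hx
  obtain ⟨n, rfl⟩ : ∃ n : ℤ, (n : 𝓞 ℚ) = x :=
    ⟨Rat.ringOfIntegersEquiv x, Rat.ringOfIntegersEquiv.injective (by simp)⟩
  have hn : (n : 𝓞 E) ∈ Q := by simpa [Ideal.mem_comap] using hx
  obtain ⟨k, rfl⟩ := (intCast_mem_iff hp hpQ n).mp hn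
  rw [Ideal.mem_comap]
  push_cast
  exact Ideal.mul_mem_right _ _ hpQ2

end Inertia

end RedeiField

namespace RedeiField

/-! ### Integers modulo the unramified 2-adic square classes. -/

section TwoAdicClass

/-- `n` is `4 ^ k` times an integer congruent to `1` modulo `4`. -/
def IsFourPowMulOneMod (n : ℤ) : Prop := ∃ (k : ℕ) (m : ℤ), n = 4 ^ k * (4 * m + 1)

theorem exists_eq_four_pow_mul {n : ℤ} (hn : n ≠ 0) : ∃ (k : ℕ) (c : ℤ), n = 4 ^ k * c ∧ ¬ 4 ∣ c := by
  obtain ⟨c, hc, h⟩ := (Int.finiteMultiplicity_iff.mpr ⟨by decide, hn⟩ :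
    FiniteMultiplicity 4 n).exists_eq_pow_mul_and_not_dvd
  exact ⟨_, c, hc, h⟩

theorem isFourPowMulOneMod_iff (k : ℕ) {c : ℤ} (hc : ¬ 4 ∣ c) :
    IsFourPowMulOneMod (4 ^ k * c) ↔ c % 4 = 1 := by
  constructor
  · rintro ⟨j, m, h⟩
    rcases lt_trichotomy k j with hkj | rfl | hkj
    · obtain ⟨d, rfl⟩ := Nat.exists_eq_add_of_lt hkj
      refine absurd ⟨4 ^ d * (4 * m + 1), ?_⟩ hc
      refine mul_left_cancel₀ (pow_ne_zero k (by norm_num : (4 : ℤ) ≠ 0)) ?_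
      rw [h]; ring
    · have := mul_left_cancel₀ (pow_ne_zero k (by norm_num : (4 : ℤ) ≠ 0)) h
      omega
    · obtain ⟨d, rfl⟩ := Nat.exists_eq_add_of_lt hkj
      have : 4 * m + 1 = 4 * (4 ^ d * c) := by
        refine mul_left_cancel₀ (pow_ne_zero j (by norm_num : (4 : ℤ) ≠ 0)) ?_
        rw [← h]; ring
      omega
  · intro h
    exact ⟨k, c / 4, by congr 1; omega⟩

theorem isFourPowMulOneMod_iff_of_not_dvd {c : ℤ} (hc : ¬ 4 ∣ c) :
    IsFourPowMulOneMod c ↔ c % 4 = 1 := by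
  simpa using isFourPowMulOneMod_iff 0 hc

theorem IsFourPowMulOneMod.mul_iff {x y : ℤ} (hx : IsFourPowMulOneMod x) (hy : y ≠ 0) :
    IsFourPowMulOneMod (x * y) ↔ IsFourPowMulOneMod y := by
  obtain ⟨j, m, rfl⟩ := hx
  obtain ⟨k, c, rfl, hc⟩ := exists_eq_four_pow_mul hy
  have h : 4 ^ j * (4 * m + 1) * (4 ^ k * c) = 4 ^ (j + k) * ((4 * m + 1) * c) := by ring
  have h4 : ((4 * m + 1) * c) % 4 = c % 4 := by
    rw [show (4 * m + 1) * c = c + 4 * (m * c) by ring]; omega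
  rw [h, isFourPowMulOneMod_iff _ hc, isFourPowMulOneMod_iff _ (by omega), h4]

theorem isFourPowMulOneMod_sq_mul_iff {t : ℤ} (ht : t = 1 ∨ t = -1 ∨ t = 2 ∨ t = -2) {n : ℤ}
    (hn : n ≠ 0) : IsFourPowMulOneMod (t * t * n) ↔ IsFourPowMulOneMod n := by
  refine IsFourPowMulOneMod.mul_iff ?_ hn
  rcases ht with rfl | rfl | rfl | rfl
  exacts [⟨0, 0, rfl⟩, ⟨0, 0, rfl⟩, ⟨1, 0, rfl⟩, ⟨1, 0, rfl⟩]

/-- The classes 1 and 5 have index 4 in ℚ₂*/ℚ₂*², with coset representatives ±1, ±2. This is the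
existence half of that statement for integers. -/
theorem exists_isFourPowMulOneMod_mul {n : ℤ} (hn : n ≠ 0) :
    ∃ t : ℤ, (t = 1 ∨ t = -1 ∨ t = 2 ∨ t = -2) ∧ IsFourPowMulOneMod (t * n) := by
  obtain ⟨k, c, rfl, hc⟩ := exists_eq_four_pow_mul hn
  have h : c % 8 = 2 ∨ c % 8 = 6 ∨ c % 4 = 1 ∨ c % 4 = 3 := by omega
  rcases h with h | h | h | h
  · refine ⟨2, by simp, k + 1, c / 8, ?_⟩
    obtain ⟨d, rfl⟩ : ∃ d, c = 8 * d + 2 := ⟨c / 8, by omega⟩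
    rw [show (8 * d + 2) / 8 = d by omega]; ring
  · refine ⟨-2, by simp, k + 1, -(c / 8) - 1, ?_⟩
    obtain ⟨d, rfl⟩ : ∃ d, c = 8 * d + 6 := ⟨c / 8, by omega⟩
    rw [show (8 * d + 6) / 8 = d by omega]; ring
  · exact ⟨1, by simp, by rw [one_mul, isFourPowMulOneMod_iff _ hc, h]⟩
  · refine ⟨-1, by simp, ?_⟩
    rw [show -1 * (4 ^ k * c) = 4 ^ k * (-c) by ring, isFourPowMulOneMod_iff _ (by omega)]
    omega

/-- The uniqueness half: (sn)(tn) = st·n² and n² has trivial class, so st has trivial class, while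
distinct s, t give st ∈ {-1, ±2, -4}. -/
theorem eq_of_isFourPowMulOneMod_mul {n s t : ℤ} (hn : n ≠ 0)
    (hs : s = 1 ∨ s = -1 ∨ s = 2 ∨ s = -2) (ht : t = 1 ∨ t = -1 ∨ t = 2 ∨ t = -2)
    (hsn : IsFourPowMulOneMod (s * n)) (htn : IsFourPowMulOneMod (t * n)) : s = t := by
  have hst : IsFourPowMulOneMod (s * t) := by
    have h := (hsn.mul_iff (y := t * n) (by rcases ht with rfl | rfl | rfl | rfl <;> omega)).mpr htn
    obtain ⟨k, c, rfl, hc⟩ := exists_eq_four_pow_mul hn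
    have hs0 : s * t ≠ 0 := by
      rcases hs with rfl | rfl | rfl | rfl <;> rcases ht with rfl | rfl | rfl | rfl <;> decide
    by_cases h2 : c % 2 = 0
    · obtain ⟨d, rfl⟩ : (2 : ℤ) ∣ c := by omega
      -- Here c = 2d with d odd, so the square of c contributes one extra factor 4.
      have h1 : IsFourPowMulOneMod (4 ^ (2 * k + 1) * (d * d)) := by
        rw [isFourPowMulOneMod_iff]
        · obtain ⟨e, rfl⟩ : ∃ e, d = 2 * e + 1 := ⟨d / 2, by omega⟩
          ring_nf; omega
        · obtain ⟨e, rfl⟩ : ∃ e, d = 2 * e + 1 := ⟨d / 2, by omega⟩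
          ring_nf; omega
      rw [show s * (4 ^ k * (2 * d)) * (t * (4 ^ k * (2 * d))) =
        4 ^ (2 * k + 1) * (d * d) * (s * t) by ring] at h
      exact (h1.mul_iff hs0).mp h
    · have h1 : IsFourPowMulOneMod (4 ^ (2 * k) * (c * c)) := by
        obtain ⟨e, rfl⟩ : ∃ e, c = 2 * e + 1 := ⟨c / 2, by omega⟩
        rw [isFourPowMulOneMod_iff]
        · ring_nf; omega
        · ring_nf; omega
      rw [show s * (4 ^ k * c) * (t * (4 ^ k * c)) = 4 ^ (2 * k) * (c * c) * (s * t) by ring] at h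
      exact (h1.mul_iff hs0).mp h
  have h4 : ¬ IsFourPowMulOneMod (-4) := by
    have := isFourPowMulOneMod_iff 1 (c := -1) (by decide)
    simpa using this
  have hm (c : ℤ) (hc : ¬ 4 ∣ c) (h : c % 4 ≠ 1) : ¬ IsFourPowMulOneMod c := by
    rwa [isFourPowMulOneMod_iff_of_not_dvd hc]
  have h1 := hm (-1) (by decide) (by decide)
  have h2 := hm 2 (by decide) (by decide)
  have h3 := hm (-2) (by decide) (by decide)
  rcases hs with rfl | rfl | rfl | rfl <;> rcases ht with rfl | rfl | rfl | rfl <;>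
    first | rfl | (exfalso; norm_num at hst; tauto)

end TwoAdicClass

/-! ### Square roots that inertia moves or fixes. -/

section Fixed

variable {L : Type*} [Field L] [NumberField L]

omit [NumberField L] in
theorem ringOfIntegers_ext {x y : 𝓞 L} (h : algebraMap (𝓞 L) L x = algebraMap (𝓞 L) L y) : x = y :=
  FaithfulSMul.algebraMap_injective (𝓞 L) L h

omit [NumberField L] in
theorem exists_integer_of_sq_eq {θ : L} {u : 𝓞 L} (h : θ ^ 2 = algebraMap (𝓞 L) L u) :
    ∃ y : 𝓞 L, algebraMap (𝓞 L) L y = θ ∧ y ^ 2 = u := by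
  have hint : IsIntegral ℤ θ := IsIntegral.of_pow two_pos (h ▸ u.2)
  exact ⟨⟨θ, hint⟩, rfl, ringOfIntegers_ext h⟩

theorem exists_inert_neg_of_sq_eq_prime [IsGalois ℚ L] {p : ℕ} (hp : p.Prime) {P : Ideal (𝓞 L)}
    [hP : P.IsPrime] (hpP : (p : 𝓞 L) ∈ P) {s : L} (hs : s ^ 2 = p) :
    ∃ σ : L ≃ₐ[ℚ] L, IsInert P (σ : L →+* L) ∧ σ s = -s := by
  obtain ⟨r, hr, hr2⟩ := exists_integer_of_sq_eq (u := p) (by simpa using hs)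
  exact exists_inert_neg_of_sq_eq (c := p) (π := r) (u := 1) (m := 0) hp hpP (by simpa using hs)
    (by simpa using hr) (fun h => hP.ne_top ((Ideal.eq_top_iff_one P).mpr h)) (by simpa using hr2)

/-- After removing powers of 4, c becomes d ≡ 2 or 3 mod 4. Then √d or 1 + √d, respectively, has
square 2 times a P-unit, so 2 ramifies in ℚ(√d). -/
theorem exists_inert_neg_of_not_isFourPowMulOneMod [IsGalois ℚ L] {P : Ideal (𝓞 L)}
    [hP : P.IsPrime] (h2P : (2 : 𝓞 L) ∈ P) {s : L} {c : ℤ} (hs : s ^ 2 = c) (hc0 : c ≠ 0)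
    (hc : ¬ IsFourPowMulOneMod c) : ∃ σ : L ≃ₐ[ℚ] L, IsInert P (σ : L →+* L) ∧ σ s = -s := by
  obtain ⟨k, d, rfl, hd⟩ := exists_eq_four_pow_mul hc0
  rw [isFourPowMulOneMod_iff k hd] at hc
  obtain ⟨r, hr, hrs⟩ : ∃ r : L, r ^ 2 = d ∧ s = 2 ^ k * r := by
    refine ⟨s / 2 ^ k, ?_, by field_simp⟩
    rw [div_pow, hs, ← pow_mul, mul_comm k, pow_mul]
    push_cast; norm_num
  suffices ∃ σ : L ≃ₐ[ℚ] L, IsInert P (σ : L →+* L) ∧ σ r = -r by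
    obtain ⟨σ, h1, h2⟩ := this
    exact ⟨σ, h1, by rw [hrs, map_mul, h2, map_pow, map_ofNat]; ring⟩
  obtain ⟨r', hrr', hr'⟩ := exists_integer_of_sq_eq (u := (d : 𝓞 L)) (by simpa using hr)
  have h2P' : ((2 : ℕ) : 𝓞 L) ∈ P := by exact_mod_cast h2P
  have hodd (n : ℤ) (hn : n % 2 = 1) : (n : 𝓞 L) ∉ P := by
    rw [intCast_mem_iff Nat.prime_two h2P']; omega
  have h : d % 4 = 2 ∨ d % 4 = 3 := by omega
  rcases h with h | h
  · obtain ⟨m, rfl⟩ : ∃ m, d = 4 * m + 2 := ⟨d / 4, by omega⟩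
    refine exists_inert_neg_of_sq_eq (c := (4 * m + 2 : ℤ)) (π := r') (u := (2 * m + 1 : ℤ)) (m := 0)
      Nat.prime_two h2P' (by rw [hr]; push_cast; rfl) (by simp [hrr']) (hodd _ (by omega)) ?_
    rw [hr']; push_cast; ring
  · obtain ⟨m, rfl⟩ : ∃ m, d = 4 * m + 3 := ⟨d / 4, by omega⟩
    -- (1 + r')² = 2(2m + 2 + r'), and the cofactor is a unit at P because r' is.
    refine exists_inert_neg_of_sq_eq (c := (4 * m + 3 : ℤ)) (π := 1 + r')
      (u := (2 * m + 2 : ℤ) + r') (m := 1)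
      Nat.prime_two h2P' (by rw [hr]; push_cast; rfl) (by simp [hrr']) ?_ ?_
    · intro hu
      have h1 : r' ∈ P := by
        refine (Ideal.add_mem_iff_right P ?_).mp hu
        rw [intCast_mem_iff Nat.prime_two h2P']; omega
      refine hodd _ (?_ : (4 * m + 3) % 2 = 1) (hr' ▸ Ideal.pow_mem_of_mem P h1 2 two_pos)
      omega
    · push_cast at hr' ⊢
      linear_combination hr'

omit [NumberField L] in
theorem IsInert.mem_of_map_eq_neg {P : Ideal (𝓞 L)} {σ : L →+* L} (hσ : IsInert P σ) {x : 𝓞 L}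
    (h : σ (algebraMap (𝓞 L) L x) = -algebraMap (𝓞 L) L x) : 2 * x ∈ P := by
  obtain ⟨y, hy, e⟩ := hσ x
  have : 2 * x = -y := by
    apply ringOfIntegers_ext
    rw [map_mul, map_neg, e, h, map_ofNat]; ring
  rw [this]
  exact P.neg_mem hy

theorem two_notMem {p : ℕ} (hp : p.Prime) (hp2 : p ≠ 2) {P : Ideal (𝓞 L)} [hP : P.IsPrime]
    (hpP : (p : 𝓞 L) ∈ P) : (2 : 𝓞 L) ∉ P := by
  have := intCast_mem_iff hp hpP 2
  push_cast at this
  rw [this]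
  intro h
  exact hp2 ((Nat.prime_dvd_prime_iff_eq hp Nat.prime_two).mp (by exact_mod_cast h))

omit [NumberField L] in
theorem map_eq_of_sq_map_eq {σ : L →+* L} {θ : L} (h : σ (θ ^ 2) = θ ^ 2) : σ θ = θ ∨ σ θ = -θ := by
  rw [map_pow] at h
  exact sq_eq_sq_iff_eq_or_eq_neg.mp h

omit [NumberField L] in
/-- For odd residue characteristic, inertia fixes square roots of units. -/
theorem IsInert.map_eq_of_sq_eq {P : Ideal (𝓞 L)} [hP : P.IsPrime] (h2 : (2 : 𝓞 L) ∉ P)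
    {σ : L →+* L} (hσ : IsInert P σ) {θ : L} {u : 𝓞 L} (hu : u ∉ P) (hθ : θ ^ 2 = algebraMap (𝓞 L) L u)
    (h : σ (algebraMap (𝓞 L) L u) = algebraMap (𝓞 L) L u) : σ θ = θ := by
  refine (map_eq_of_sq_map_eq (by rw [hθ, h])).resolve_right fun hneg => hu ?_
  obtain ⟨θ', rfl, h3⟩ := exists_integer_of_sq_eq hθ
  have h1 : 2 * θ' ∈ P := hσ.mem_of_map_eq_neg hneg
  rw [← h3]
  exact Ideal.pow_mem_of_mem P ((hP.mem_or_mem h1).resolve_left h2) 2 two_pos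

/-- For residue characteristic `2`, inertia fixes square roots of units that are squares
modulo `4`. -/
theorem IsInert.map_eq_of_sq_eq_sq_add {P : Ideal (𝓞 L)} [hP : P.IsPrime] (h2 : (2 : 𝓞 L) ∈ P)
    {σ : L →+* L} (hσ : IsInert P σ) {θ : L} {s e : 𝓞 L} (hs : s ∉ P)
    (hθ : θ ^ 2 = algebraMap (𝓞 L) L s ^ 2 + 4 * algebraMap (𝓞 L) L e)
    (hσs : σ (algebraMap (𝓞 L) L s) = algebraMap (𝓞 L) L s) (h : σ (θ ^ 2) = θ ^ 2) : σ θ = θ := by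
  refine (map_eq_of_sq_map_eq h).resolve_right fun hneg => hs ?_
  -- (s + θ)/2 is a root of X² - sX - e. A sign change of θ would move it by -θ, forcing θ into P
  -- and hence s too, since θ² ≡ s² modulo 2.
  have hint : IsIntegral ℤ ((algebraMap (𝓞 L) L s + θ) / 2) := by
    have h1 : IsIntegral (𝓞 L) ((algebraMap (𝓞 L) L s + θ) / 2) := by
      refine ⟨Polynomial.X ^ 2 - Polynomial.C s * Polynomial.X - Polynomial.C e, by monicity!, ?_⟩
      simp
      linear_combination hθ / 4
    exact isIntegral_trans _ h1
  obtain ⟨y, hy, e1⟩ := hσ ⟨_, hint⟩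
  have h3 : algebraMap (𝓞 L) L y = -θ := by
    rw [e1]
    change σ ((algebraMap (𝓞 L) L s + θ) / 2) - (algebraMap (𝓞 L) L s + θ) / 2 = -θ
    rw [map_div₀, map_add, hσs, hneg, map_ofNat]; ring
  have h4 : s ^ 2 = y ^ 2 - 2 * (2 * e) := by
    apply ringOfIntegers_ext
    simp only [map_sub, map_pow, map_mul, map_ofNat]
    rw [h3, neg_sq, hθ]; ring
  have h5 : s ^ 2 ∈ P := by
    rw [h4]
    exact P.sub_mem (Ideal.pow_mem_of_mem P hy 2 two_pos) (P.mul_mem_right _ h2)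
  exact hP.mem_of_pow_mem 2 h5

end Fixed

end RedeiField

namespace RedeiField

/-! ### The conic identity and non-vanishing of u + v√n. -/

section Conic

variable {L : Type*} [Field L]

theorem add_mul_sqrt_ne_zero [CharZero L] {n : ℤ} (hn : Squarefree n) (hn1 : n ≠ 1) {s : L}
    (hs : s ^ 2 = n) {u v : ℚ} (h : u ≠ 0 ∨ v ≠ 0) : (u : L) + v * s ≠ 0 := by
  intro h0
  have h1 : u ^ 2 = n * v ^ 2 := by
    have : (u : L) ^ 2 = n * v ^ 2 := by linear_combination (u - v * s) * h0 + v ^ 2 * hs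
    exact_mod_cast this
  by_cases hv : v = 0
  · subst hv
    simp at h1
    simp [h1] at h
  · have h2 : (u / v) ^ 2 = n := by field_simp; linear_combination h1
    have h3 : IsSquare (n : ℚ) := ⟨u / v, by rw [← h2]; ring⟩
    rw [Rat.isSquare_intCast_iff] at h3
    obtain ⟨d, hd⟩ := h3
    have := hn d ⟨1, by rw [hd]; ring⟩
    rcases Int.isUnit_iff.mp this with rfl | rfl <;> simp at hd <;> exact hn1 hd

/-- The square roots of `q (x + y√a)` and of `(2 / q) (x + z√b)` generate the same field. -/
theorem sq_div_eq {a b q x y z A B R : L} (hA : A ^ 2 = a) (hB : B ^ 2 = b) (hR0 : R ≠ 0)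
    (hR : R ^ 2 = q * (x + y * A)) (heq : x ^ 2 - a * y ^ 2 = b * z ^ 2) :
    q * ((x + z * B + y * A) / R) ^ 2 = 2 * (x + z * B) := by
  have hq : q * (x + y * A) ≠ 0 := by rw [← hR]; exact pow_ne_zero 2 hR0
  have hq1 := left_ne_zero_of_mul hq
  have hq2 := right_ne_zero_of_mul hq
  rw [div_pow, hR]
  field_simp
  -- On the conic, (x + yA + zB)² = 2(x + yA)(x + zB).
  linear_combination y ^ 2 * hA + z ^ 2 * hB - heq

end Conic

/-! ### Inertia fixes √(tβ): the local cases. -/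

section Fixed

variable {L : Type*} [Field L] [NumberField L] {P : Ideal (𝓞 L)} [hP : P.IsPrime] {σ : L →+* L}

theorem IsInert.map_eq_of_sq_eq_intCast {p : ℕ} (hp : p.Prime) (hp2 : p ≠ 2)
    (hpP : (p : 𝓞 L) ∈ P) (hσ : IsInert P σ) {s : L} {n : ℤ} (hs : s ^ 2 = n)
    (hn : ¬ (p : ℤ) ∣ n) : σ s = s :=
  hσ.map_eq_of_sq_eq (two_notMem hp hp2 hpP) (u := n) (by rwa [intCast_mem_iff hp hpP])
    (by simpa using hs) (by simp)

theorem exists_integer_half {A : L} {a : ℤ} (hA : A ^ 2 = a) (ha : a % 4 = 1) :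
    ∃ ω : 𝓞 L, A = 2 * algebraMap (𝓞 L) L ω - 1 := by
  obtain ⟨k, rfl⟩ : ∃ k, a = 4 * k + 1 := ⟨a / 4, by omega⟩
  have hint : IsIntegral ℤ ((1 + A) / 2) := by
    refine ⟨Polynomial.X ^ 2 - Polynomial.X - Polynomial.C k, by monicity!, ?_⟩
    push_cast at hA
    rw [Polynomial.eval₂_sub, Polynomial.eval₂_sub, Polynomial.eval₂_pow, Polynomial.eval₂_X,
      Polynomial.eval₂_C, algebraMap_int_eq, eq_intCast]
    linear_combination hA / 4
  refine ⟨⟨_, hint⟩, ?_⟩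
  change A = 2 * ((1 + A) / 2) - 1
  ring

/-- For residue characteristic `2`, inertia fixes the square root of `u + v√a` if `v` is even and
`u - v ≡ 1` modulo `4`. -/
theorem IsInert.map_eq_of_sq_eq_add_mul (h2 : (2 : 𝓞 L) ∈ P) (hσ : IsInert P σ) {A R : L} {a u v : ℤ}
    (hA : A ^ 2 = a) (ha : a % 4 = 1) (hσA : σ A = A) (hR : R ^ 2 = u + v * A) (hv : v % 2 = 0)
    (huv : (u - v) % 4 = 1) : σ R = R := by
  obtain ⟨ω, hω⟩ := exists_integer_half hA ha
  obtain ⟨w, rfl⟩ : ∃ w, v = 2 * w := ⟨v / 2, by omega⟩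
  obtain ⟨k, rfl⟩ : ∃ k, u = 4 * k + 1 + 2 * w := ⟨(u - 2 * w) / 4, by omega⟩
  -- With A = 2ω - 1, v = 2w and u = 4k + 1 + 2w, one gets u + vA = 1 + 4(k + wω).
  refine hσ.map_eq_of_sq_eq_sq_add h2 (s := 1) (e := k + w * ω)
    (fun h => hP.ne_top ((Ideal.eq_top_iff_one P).mpr h)) ?_ (by simp) ?_
  · rw [hR, hω]; simp; ring
  · rw [hR]; simp [hσA, map_ofNat σ]

theorem IsInert.map_eq_of_sq_eq_intCast_two (h2 : (2 : 𝓞 L) ∈ P) (hσ : IsInert P σ) {s : L} {n : ℤ}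
    (hs : s ^ 2 = n) (hn : n % 4 = 1) : σ s = s :=
  hσ.map_eq_of_sq_eq_add_mul h2 (A := 1) (a := 1) (u := n) (v := 0) (by simp) rfl (map_one σ)
    (by simpa using hs) rfl (by simpa using hn)

variable {A B R : L} {a b X Y Z : ℤ}

/-- By primitivity P cannot contain both X + YA and X - YA. If the first is not a unit at P, the
second is; its square root is ZB/R, and fixing ZB/R and B amounts to fixing R. -/
theorem IsInert.map_eq_of_not_dvd {p : ℕ} (hp : p.Prime) (hp2 : p ≠ 2) (hpP : (p : 𝓞 L) ∈ P)
    (hσ : IsInert P σ) (hA : A ^ 2 = a) (hB : B ^ 2 = b) (hσA : σ A = A) (hσB : σ B = B)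
    (hR0 : R ≠ 0) (hR : R ^ 2 = X + Y * A) (heq : X ^ 2 - a * Y ^ 2 = b * Z ^ 2)
    (ha : ¬ (p : ℤ) ∣ a) (hb : ¬ (p : ℤ) ∣ b) (hprim : ¬ ((p : ℤ) ∣ X ∧ (p : ℤ) ∣ Y ∧ (p : ℤ) ∣ Z)) :
    σ R = R := by
  have h2 := two_notMem hp hp2 hpP
  obtain ⟨A', rfl, hA'⟩ := exists_integer_of_sq_eq (u := (a : 𝓞 L)) (by simpa using hA)
  by_cases hu : (X + Y * A' : 𝓞 L) ∈ P
  · have hpZ := Nat.prime_iff_prime_int.mp hp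
    have hu' : (X - Y * A' : 𝓞 L) ∉ P := by
      intro hu'
      have h1 : (2 : 𝓞 L) * X ∈ P := by convert P.add_mem hu hu' using 1; ring
      have hX := (hP.mem_or_mem h1).resolve_left h2
      have hYA : (Y * A' : 𝓞 L) ∈ P := by convert P.sub_mem hu hX using 1; ring
      have hX' := (intCast_mem_iff hp hpP X).mp hX
      have hYA2 : ((Y ^ 2 * a : ℤ) : 𝓞 L) ∈ P := by
        have := Ideal.pow_mem_of_mem P hYA 2 two_pos
        rw [mul_pow, hA'] at this
        exact_mod_cast this
      have hY : (p : ℤ) ∣ Y := hpZ.dvd_of_dvd_pow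
        ((hpZ.dvd_or_dvd ((intCast_mem_iff hp hpP _).mp hYA2)).resolve_right ha)
      have hZ2 : (p : ℤ) ∣ b * Z ^ 2 := by
        rw [← heq]
        exact dvd_sub (dvd_pow hX' two_ne_zero) (Dvd.dvd.mul_left (dvd_pow hY two_ne_zero) a)
      exact hprim ⟨hX', hY, hpZ.dvd_of_dvd_pow ((hpZ.dvd_or_dvd hZ2).resolve_left hb)⟩
    have hS2 : (Z * B / R) ^ 2 = algebraMap (𝓞 L) L (X - Y * A') := by
      have h0 := pow_ne_zero 2 hR0
      rw [hR] at h0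
      have heq' : (X : L) ^ 2 - a * Y ^ 2 = b * Z ^ 2 := by exact_mod_cast heq
      rw [div_pow, mul_pow, hB, hR, div_eq_iff h0]
      simp
      linear_combination Y ^ 2 * hA - heq'
    have hS := hσ.map_eq_of_sq_eq h2 hu' hS2 (by simp [hσA])
    have hS0 : Z * B / R ≠ 0 := by
      intro h
      rw [h, zero_pow two_ne_zero] at hS2
      have : (X - Y * A' : 𝓞 L) = 0 := ringOfIntegers_ext (by rw [← hS2, map_zero])
      exact hu' (this ▸ P.zero_mem)
    have h3 : R = Z * B / (Z * B / R) := by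
      have : (Z : L) * B ≠ 0 := fun h => hS0 (by rw [h, zero_div])
      rw [div_div_cancel₀ this]
    rw [h3, map_div₀, hS, map_mul, hσB, map_intCast]
  · exact hσ.map_eq_of_sq_eq h2 hu (by simpa using hR) (by simp [hσA])

/-- As A ∈ P and p ∤ X, the element X + YA is a unit at P. A factor r = p is harmless: writing a =
pd, it is absorbed by the fixed element A, because (RA/p)² = (X + YA)d. -/
theorem IsInert.map_eq_of_dvd {p : ℕ} (hp : p.Prime) (hp2 : p ≠ 2) (hpP : (p : 𝓞 L) ∈ P)
    (hσ : IsInert P σ) (hA : A ^ 2 = a) (hσA : σ A = A) {r : ℤ} (hr : r = 1 ∨ r = p)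
    (hR : R ^ 2 = r * (X + Y * A)) (heq : X ^ 2 - a * Y ^ 2 = b * Z ^ 2) (ha0 : Squarefree a)
    (ha : (p : ℤ) ∣ a) (hb : ¬ (p : ℤ) ∣ b) (hprim : ¬ ((p : ℤ) ∣ X ∧ (p : ℤ) ∣ Y ∧ (p : ℤ) ∣ Z)) :
    σ R = R := by
  have h2 := two_notMem hp hp2 hpP
  have hpZ := Nat.prime_iff_prime_int.mp hp
  have hp0 : (p : ℤ) ≠ 0 := hpZ.ne_zero
  obtain ⟨A', rfl, hA'⟩ := exists_integer_of_sq_eq (u := (a : 𝓞 L)) (by simpa using hA)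
  obtain ⟨d, hd⟩ := ha
  have hpd : ¬ (p : ℤ) ∣ d := by
    rintro ⟨e, rfl⟩
    have := ha0 p ⟨e, by rw [hd]; ring⟩
    exact hpZ.not_isUnit this
  have hX : ¬ (p : ℤ) ∣ X := by
    intro hX
    have hZ2 : (p : ℤ) ∣ b * Z ^ 2 := by
      rw [← heq, hd]
      exact dvd_sub (dvd_pow hX two_ne_zero) ⟨d * Y ^ 2, by ring⟩
    have hZ := hpZ.dvd_of_dvd_pow ((hpZ.dvd_or_dvd hZ2).resolve_left hb)
    obtain ⟨X', rfl⟩ := hX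
    obtain ⟨Z', rfl⟩ := hZ
    have h3 : d * Y ^ 2 = p * (X' ^ 2 - b * Z' ^ 2) := by
      refine mul_left_cancel₀ hp0 ?_
      rw [hd] at heq
      linear_combination -heq
    have h4 : (p : ℤ) ∣ d * Y ^ 2 := ⟨_, h3⟩
    exact hprim ⟨⟨X', rfl⟩, hpZ.dvd_of_dvd_pow ((hpZ.dvd_or_dvd h4).resolve_left hpd), ⟨Z', rfl⟩⟩
  have hA'P : A' ∈ P := by
    refine hP.mem_of_pow_mem 2 ?_
    rw [hA', intCast_mem_iff hp hpP]
    exact ⟨d, hd⟩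
  have hu : (X + Y * A' : 𝓞 L) ∉ P := by
    intro h
    have : (X : 𝓞 L) ∈ P := by convert P.sub_mem h (P.mul_mem_left Y hA'P) using 1; ring
    exact hX ((intCast_mem_iff hp hpP X).mp this)
  rcases hr with rfl | rfl
  · exact hσ.map_eq_of_sq_eq h2 hu (by simpa using hR) (by simp [hσA])
  · have hp0' : (p : L) ≠ 0 := by exact_mod_cast hp.ne_zero
    have hA0 : algebraMap (𝓞 L) L A' ≠ 0 := by
      intro h
      rw [h] at hA
      exact ha0.ne_zero (by exact_mod_cast (by simpa using hA.symm : (a : L) = 0))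
    have hθ : (R * algebraMap (𝓞 L) L A' / p) ^ 2 = algebraMap (𝓞 L) L ((X + Y * A') * d) := by
      rw [div_pow, mul_pow, hR, hA, hd]
      push_cast
      simp only [map_intCast]
      field_simp
    have h5 := hσ.map_eq_of_sq_eq h2 (u := (X + Y * A') * d)
      (fun h => (hP.mem_or_mem h).elim hu fun h => hpd ((intCast_mem_iff hp hpP d).mp h))
      hθ (by simp [hσA])
    rw [map_div₀, map_mul, hσA, map_natCast] at h5
    field_simp at h5
    exact h5

/-- When Z rather than Y is even, the conic identity exchanges √(2δ(X + YA)) for √(δ(X + ZB)), to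
which the criterion modulo 4 applies with B in the role of A. -/
theorem IsInert.map_eq_of_swap (hσ : IsInert P σ) (h2 : (2 : 𝓞 L) ∈ P)
    (hA : A ^ 2 = a) (hB : B ^ 2 = b) (hb : b % 4 = 1) (hσA : σ A = A) (hσB : σ B = B)
    (hR0 : R ≠ 0) {δ : ℤ} (hδ : δ = 1 ∨ δ = -1) (hR : R ^ 2 = 2 * δ * (X + Y * A))
    (heq : X ^ 2 - a * Y ^ 2 = b * Z ^ 2) (hXB : (X : L) + Z * B ≠ 0)
    (hZ : Z % 2 = 0) (hXZ : (δ * (X - Z)) % 4 = 1) : σ R = R := by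
  have heq' : (X : L) ^ 2 - a * Y ^ 2 = b * Z ^ 2 := by exact_mod_cast heq
  have h := sq_div_eq hA hB hR0 hR heq'
  set S := (X + Z * B + Y * A) / R with hSdef
  have hS : S ^ 2 = (δ * X : ℤ) + (δ * Z : ℤ) * B := by
    rcases hδ with rfl | rfl <;> push_cast at h ⊢
    · linear_combination h / 2
    · linear_combination -h / 2
  have hσS : σ S = S := by
    refine hσ.map_eq_of_sq_eq_add_mul h2 hB hb hσB hS ?_ ?_
    · rcases hδ with rfl | rfl <;> omega
    · rw [← mul_sub]; exact hXZ
  have hS0 : S ≠ 0 := by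
    intro h0
    rw [h0] at h
    simp at h
    exact hXB h
  have h3 : R = (X + Z * B + Y * A) / S := by
    rw [hSdef] at hS0 ⊢
    have : (X : L) + Z * B + Y * A ≠ 0 := fun h => hS0 (by rw [h, zero_div])
    field_simp
  rw [h3, map_div₀, hσS]
  simp [hσA, hσB]

/-- The integer w approximates a 2-adic square root of b, so one of ±B is P-adically close to w and
X ± ZB may be replaced by X + Zw. The factor e ∈ {1, a} is a square of a fixed element, so the
condition is imposed only up to it. -/
theorem IsInert.map_eq_of_split (hσ : IsInert P σ) (h2 : (2 : 𝓞 L) ∈ P)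
    (hA : A ^ 2 = a) (hB : B ^ 2 = b) (hb : b % 4 = 1) (hσA : σ A = A) (hσB : σ B = B) (ha0 : a ≠ 0)
    (hR0 : R ≠ 0) {t : ℤ} (hR : R ^ 2 = t * (X + Y * A))
    (heq : X ^ 2 - a * Y ^ 2 = b * Z ^ 2) (hXB : (X : L) + Z * B ≠ 0) (hXB' : (X : L) - Z * B ≠ 0)
    {w c m e : ℤ} {k : ℕ} (hw : w % 2 = 1) (hwb : b - w ^ 2 = 4 ^ (k + 1) * c) (he : e = 1 ∨ e = a)
    (ht : 2 * t * e * (X + Z * w) = 4 ^ k * (4 * m + 1)) : σ R = R := by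
  have h2' : ((2 : ℕ) : 𝓞 L) ∈ P := by exact_mod_cast h2
  have heq' : (X : L) ^ 2 - a * Y ^ 2 = b * Z ^ 2 := by exact_mod_cast heq
  have hwb' : (b : L) - w ^ 2 = 4 ^ (k + 1) * c := by exact_mod_cast hwb
  have ht' : 2 * (t : L) * e * (X + Z * w) = 4 ^ k * (4 * m + 1) := by exact_mod_cast ht
  have hA0 : A ≠ 0 := by
    rintro rfl
    exact ha0 (by exact_mod_cast (by simpa using hA.symm : (a : L) = 0))
  obtain ⟨E, hE, hσE, hE0⟩ : ∃ E : L, E ^ 2 = e ∧ σ E = E ∧ E ≠ 0 := by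
    rcases he with rfl | rfl
    · exact ⟨1, by simp, by simp, one_ne_zero⟩
    · exact ⟨A, hA, hσA, hA0⟩
  -- the square root of `b` that is `P`-adically close to `w`
  obtain ⟨C, ν, hC, hσC, hXC, hν, hs⟩ : ∃ (C : L) (ν : 𝓞 L), C ^ 2 = b ∧ σ C = C ∧
      (X : L) + Z * C ≠ 0 ∧ C = w + 2 * algebraMap (𝓞 L) L ν ∧ ν + w ∉ P := by
    obtain ⟨ω, hω⟩ := exists_integer_half hB hb
    obtain ⟨v, rfl⟩ : ∃ v, w = 2 * v + 1 := ⟨w / 2, by omega⟩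
    by_cases h : (ω - 1 - v + (2 * v + 1 : ℤ) : 𝓞 L) ∈ P
    · refine ⟨-B, -ω - v, by rw [neg_sq, hB], by rw [map_neg, hσB], by rwa [mul_neg, ← sub_eq_add_neg],
        by rw [hω]; simp; ring, fun h' => ?_⟩
      have h3 := P.add_mem h h'
      have h4 : ((ω - 1 - v + (2 * v + 1 : ℤ)) + (-ω - v + (2 * v + 1 : ℤ)) : 𝓞 L) =
          ((2 * v + 1 : ℤ) : 𝓞 L) := by push_cast; ring
      rw [h4, intCast_mem_iff Nat.prime_two h2'] at h3
      omega
    · exact ⟨B, ω - 1 - v, hB, hσB, hXB, by rw [hω]; simp; ring, h⟩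
  have hG := sq_div_eq hA hC hR0 hR heq'
  set G := (X + Z * C + Y * A) / R with hGdef
  set s : 𝓞 L := ν + w with hsdef
  have hsL : algebraMap (𝓞 L) L s = algebraMap (𝓞 L) L ν + w := by simp [hsdef]
  have hνs : algebraMap (𝓞 L) L ν * algebraMap (𝓞 L) L s = 4 ^ k * c := by
    rw [hsL]
    rw [hν] at hC
    linear_combination (hC + hwb') / 4
  have hσν : σ (algebraMap (𝓞 L) L ν) = algebraMap (𝓞 L) L ν := by
    have : algebraMap (𝓞 L) L ν = (C - w) / 2 := by rw [hν]; ring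
    rw [this]; simp [hσC, map_ofNat σ]
  have hσs : σ (algebraMap (𝓞 L) L s) = algebraMap (𝓞 L) L s := by
    rw [hsL, map_add, hσν, map_intCast]
  -- Since tG² = 2(X + Zw + 2Zν), the square is s²(4m + 1) + 4s²teZν/4^k. The factor s, a unit only
  -- at P, clears the denominator through νs = (b - w²)/4 = 4^k c.
  have hθ : (algebraMap (𝓞 L) L s * (t * G) * E / 2 ^ k) ^ 2 = algebraMap (𝓞 L) L s ^ 2 +
      4 * algebraMap (𝓞 L) L (s ^ 2 * m + s * (t * e * Z * c)) := by
    have h4 : ((2 : L) ^ k) ^ 2 = 4 ^ k := by rw [← pow_mul, mul_comm, pow_mul]; norm_num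
    rw [div_pow, h4, div_eq_iff (pow_ne_zero k (by norm_num))]
    simp only [map_add, map_mul, map_pow, map_intCast]
    rw [hν] at hG
    linear_combination (algebraMap (𝓞 L) L s) ^ 2 * E ^ 2 * t * hG +
      (algebraMap (𝓞 L) L s) ^ 2 * 2 * t * (X + Z * (w + 2 * algebraMap (𝓞 L) L ν)) * hE +
      (algebraMap (𝓞 L) L s) ^ 2 * ht' + 4 * t * e * Z * (algebraMap (𝓞 L) L s) * hνs
  have hs0 : algebraMap (𝓞 L) L s ≠ 0 := by
    intro h
    exact hs ((ringOfIntegers_ext (by rw [h, map_zero]) : s = 0) ▸ P.zero_mem)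
  have hG0 : G ≠ 0 := by
    intro h0
    rw [h0] at hG
    simp at hG
    exact hXC hG
  have ht0 : (t : L) ≠ 0 := by
    intro h0
    rw [h0, zero_mul] at hR
    exact hR0 (by simpa using hR)
  have h5 := hσ.map_eq_of_sq_eq_sq_add h2 hs hθ hσs (by rw [hθ]; simp [hσs, map_ofNat σ])
  have h6 : σ G = G := by
    simp only [map_div₀, map_mul, hσs, hσE, map_pow, map_ofNat, map_intCast] at h5
    field_simp at h5
    exact h5
  have h3 : R = (X + Z * C + Y * A) / G := by
    rw [hGdef] at hG0 ⊢
    have : (X : L) + Z * C + Y * A ≠ 0 := fun h => hG0 (by rw [h, zero_div])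
    field_simp
  rw [h3, map_div₀, h6]
  simp [hσA, hσC]

end Fixed

end RedeiField

namespace RedeiField

/-! ### From fixed generators to unramifiedness, and obstructions at 2. -/

section Criteria

variable {K L : Type*} [Field K] [NumberField K] [Field L] [NumberField L] [Algebra K L]

theorem exists_prime_over (L : Type*) [Field L] [NumberField L] {p : ℕ} (hp : p.Prime) :
    ∃ P : Ideal (𝓞 L), P.IsPrime ∧ (p : 𝓞 L) ∈ P := by
  have hmax : (Ideal.span {(p : ℤ)}).IsMaximal :=
    ((Ideal.span_singleton_prime (by exact_mod_cast hp.ne_zero)).mpr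
      (Nat.prime_iff_prime_int.mp hp)).isMaximal (by simpa using hp.ne_zero)
  obtain ⟨P, hP, h⟩ := Ideal.exists_ideal_over_maximal_of_isIntegral (S := 𝓞 L)
    (Ideal.span {(p : ℤ)}) (by
      rw [(RingHom.injective_iff_ker_eq_bot _).mp (FaithfulSMul.algebraMap_injective ℤ (𝓞 L))]
      exact bot_le)
  refine ⟨P, hP.isPrime, ?_⟩
  have : (p : ℤ) ∈ P.comap (algebraMap ℤ (𝓞 L)) := by
    rw [h]; exact Ideal.mem_span_singleton_self _
  simpa using this

/-- If inertia elements of `Gal(L/K)` fix generators of `L`, then `L/K` is unramified. -/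
theorem unramifiedOver_of_generators [IsGalois ℚ L] {p : ℕ} (hp : p.Prime) {A B R : L}
    (hgen : ∀ σ : L →+* L, σ A = A → σ B = B → σ R = R → ∀ x, σ x = x)
    (h : ∀ P : Ideal (𝓞 L), P.IsPrime → (p : 𝓞 L) ∈ P → ∀ σ : L →+* L,
      IsInert P σ → (∀ k : K, σ (algebraMap K L k) = algebraMap K L k) →
      σ A = A ∧ σ B = B ∧ σ R = R) : UnramifiedOver K L p := by
  have : IsGalois K L := IsGalois.tower_top_of_isGalois ℚ K L
  refine unramifiedOver_of_inert hp fun P hP hpP σ hσ => ?_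
  obtain ⟨h1, h2, h3⟩ := h P hP hpP σ hσ σ.commutes
  ext x
  exact hgen σ h1 h2 h3 x

theorem UnramifiedOver.map_eq_of_inert_rat [IsGalois ℚ L] {p : ℕ} (hp : p.Prime)
    (h : UnramifiedOver K L p) {M : Type*} [Field M] [NumberField M] [Algebra K M]
    (i : L →ₐ[K] M) {P : Ideal (𝓞 M)} [P.IsPrime] (hpP : (p : 𝓞 M) ∈ P)
    {σ : M ≃ₐ[ℚ] M} (hσ : IsInert P (σ : M →+* M))
    (hK : ∀ k : K, σ (algebraMap K M k) = algebraMap K M k) (x : L) : σ (i x) = i x := by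
  have : IsGalois K L := IsGalois.tower_top_of_isGalois ℚ K L
  exact h.map_eq_of_inert hp i hpP (σ := AlgEquiv.ofRingEquiv (f := (σ : M ≃+* M)) hK) hσ x

omit [NumberField L] in
theorem map_sqrt_eq_of_map_mul_eq {σ : L →+* L} {A B : L} (hB0 : B ≠ 0) (hB : σ B = B)
    (h : σ (A * B) = A * B) : σ A = A := by
  rw [map_mul, hB] at h
  exact mul_right_cancel₀ hB0 h

open scoped Pointwise in
theorem exists_frobenius_two [IsGalois ℚ L] {P : Ideal (𝓞 L)} [hP : P.IsPrime]
    (h2 : (2 : 𝓞 L) ∈ P) : ∃ τ : L ≃ₐ[ℚ] L, (∀ y ∈ P, τ • y ∈ P) ∧ ∀ x : 𝓞 L, τ • x - x ^ 2 ∈ P := by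
  have hunder : P.under ℤ = Ideal.span {((2 : ℕ) : ℤ)} := by
    ext n
    rw [Ideal.under, Ideal.mem_comap, Ideal.mem_span_singleton, eq_intCast,
      intCast_mem_iff Nat.prime_two (by exact_mod_cast h2)]
  have hcard : Nat.card (ℤ ⧸ P.under ℤ) = 2 := by
    rw [hunder, Nat.card_congr (Int.quotientSpanNatEquivZMod 2).toEquiv, Nat.card_zmod]
  have hfin : Finite (𝓞 L ⧸ P) :=
    Ring.HasFiniteQuotients.finiteQuotient (ne_bot_of_natCast_mem Nat.prime_two (by exact_mod_cast h2))
  have hinv : Algebra.IsInvariant ℤ (𝓞 L) (L ≃ₐ[ℚ] L) := by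
    refine ⟨fun x hx => ?_⟩
    obtain ⟨y, rfl⟩ := Algebra.IsInvariant.isInvariant (A := 𝓞 ℚ) (G := L ≃ₐ[ℚ] L) x hx
    exact ⟨Rat.ringOfIntegersEquiv y, by
      rw [← Rat.ringOfIntegersEquiv.symm_apply_apply y]; simp⟩
  obtain ⟨τ, hτ⟩ := IsArithFrobAt.exists_of_isInvariant ℤ (L ≃ₐ[ℚ] L) P
  refine ⟨τ, fun y hy => ?_, fun x => ?_⟩
  · have := MulAction.mem_stabilizer_iff.mp hτ.mem_stabilizer
    rw [← this]
    exact Ideal.smul_mem_pointwise_smul τ y P hy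
  · have := hτ x
    rwa [hcard] at this

/-- Inertia contains σ with σA = -A, and a Frobenius τ has τB = -B. The element ρ = σ·τστ⁻¹ lies in
inertia and fixes A and B, hence K. But it negates a square root G₁ of 2(x + zB)/q lying in L. -/
theorem not_unramifiedOver_two_of_inert [IsGalois ℚ L] {A B R : L} {a b : ℤ} {q x y z : ℚ}
    (hA : A ^ 2 = a) (hB : B ^ 2 = b) (hR0 : R ≠ 0) (hR : R ^ 2 = q * (x + y * A))
    (heq : x ^ 2 - a * y ^ 2 = b * z ^ 2) (hy : y ≠ 0) (ha : a % 4 = 3) (hb : b % 8 = 5)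
    (hK : ∀ σ : L →+* L, σ A = A → σ B = B → ∀ k : K, σ (algebraMap K L k) = algebraMap K L k) :
    ¬ UnramifiedOver K L 2 := by
  intro hunr
  obtain ⟨P, hP, h2'⟩ := exists_prime_over L Nat.prime_two
  have h2 : (2 : 𝓞 L) ∈ P := by exact_mod_cast h2'
  have ha0 : a ≠ 0 := by omega
  have hA0 : A ≠ 0 := by
    rintro rfl
    exact ha0 (by exact_mod_cast (by simpa using hA.symm : (a : L) = 0))
  obtain ⟨σ, hσ, hσA⟩ := exists_inert_neg_of_not_isFourPowMulOneMod h2 hA ha0 (by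
    rw [isFourPowMulOneMod_iff_of_not_dvd (by omega)]; omega)
  have hσB : σ B = B := hσ.map_eq_of_sq_eq_intCast_two h2 hB (by omega)
  obtain ⟨τ, hτP, hτ⟩ := exists_frobenius_two h2
  have hτA : τ A = A ∨ τ A = -A := map_eq_of_sq_map_eq (σ := (τ : L →+* L)) (by rw [hA]; simp)
  -- Here b ≡ 5 mod 8 enters: for ω = (1 + B)/2, ω² - ω = (b - 1)/4 is odd, so ω² ≢ ω modulo P and
  -- Frobenius cannot fix ω.
  have hτB : τ B = -B := by
    refine (map_eq_of_sq_map_eq (σ := (τ : L →+* L)) (by rw [hB]; simp)).resolve_left fun h => ?_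
    change τ B = B at h
    obtain ⟨ω, hω⟩ := exists_integer_half hB (by omega)
    obtain ⟨k, rfl⟩ : ∃ k, b = 8 * k + 5 := ⟨b / 8, by omega⟩
    have h3 : τ • ω - ω ^ 2 = ((-(2 * k + 1) : ℤ) : 𝓞 L) := by
      apply ringOfIntegers_ext
      have h4 : algebraMap (𝓞 L) L (τ • ω) = algebraMap (𝓞 L) L ω := by
        change τ (algebraMap (𝓞 L) L ω) = _
        have : algebraMap (𝓞 L) L ω = (B + 1) / 2 := by rw [hω]; ring
        rw [this, map_div₀, map_add, h, map_one, map_ofNat]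
      rw [hω] at hB
      simp only [map_sub, map_pow, h4, map_intCast]
      push_cast at hB ⊢
      linear_combination -hB / 4
    have h5 := hτ ω
    rw [h3, intCast_mem_iff Nat.prime_two h2'] at h5
    omega
  have hτi : τ⁻¹ B = -B := by
    have := DFunLike.congr_arg (τ⁻¹ : L ≃ₐ[ℚ] L) hτB
    rw [map_neg, ← AlgEquiv.mul_apply, inv_mul_cancel, AlgEquiv.one_apply] at this
    rw [eq_neg_iff_add_eq_zero] at this ⊢
    linear_combination this
  set ρ := σ * (τ * σ * τ⁻¹) with hρ
  have hρin : IsInert P (ρ : L →+* L) := by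
    rw [isInert_iff_mem_inertia] at hσ ⊢
    refine mul_mem hσ ?_
    rw [AddSubgroup.mem_inertia] at hσ ⊢
    intro x
    have h3 := hτP _ (hσ (τ⁻¹ • x))
    rw [smul_sub, smul_inv_smul] at h3
    simpa [mul_smul] using h3
  have hτiA : τ⁻¹ A = A ∨ τ⁻¹ A = -A :=
    map_eq_of_sq_map_eq (σ := ((τ⁻¹ : L ≃ₐ[ℚ] L) : L →+* L)) (by rw [hA]; simp)
  have hρA : ρ A = A := by
    simp only [hρ, AlgEquiv.mul_apply]
    rcases hτA with h | h <;> rcases hτiA with h' | h' <;> simp [h, h', hσA]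
    · have := congrArg τ h'
      rw [← AlgEquiv.mul_apply, mul_inv_cancel, AlgEquiv.one_apply, map_neg, h] at this
      exact this.symm
    · have := congrArg τ h'
      rw [← AlgEquiv.mul_apply, mul_inv_cancel, AlgEquiv.one_apply, h] at this
      exact this.symm
  have hρB : ρ B = B := by
    simp [hρ, AlgEquiv.mul_apply, hτi, hτB, hσB]
  have hρ1 (x : L) : ρ x = x :=
    hunr.map_eq_of_inert_rat Nat.prime_two (AlgHom.id K L) h2' hρin (hK ρ hρA hρB) x
  have heq' : (x : L) ^ 2 - a * y ^ 2 = b * z ^ 2 := by exact_mod_cast heq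
  have hG1 := sq_div_eq hA hB hR0 hR heq'
  have hG2 := sq_div_eq hA (B := -B) (by rwa [neg_sq]) hR0 hR heq'
  have hqA : (q : L) * (x + y * A) ≠ 0 := by rw [← hR]; exact pow_ne_zero 2 hR0
  have hq0 : (q : L) ≠ 0 := left_ne_zero_of_mul hqA
  have hG12 : q * (((x + z * B + y * A) / R) * ((x + z * -B + y * A) / R)) = 2 * y * A := by
    have hA1 := right_ne_zero_of_mul hqA
    rw [div_mul_div_comm, ← pow_two, hR]
    field_simp
    linear_combination -(z : L) ^ 2 * hB + heq' - (y : L) ^ 2 * hA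
  set G₁ := (x + z * B + y * A) / R
  set G₂ := (x + z * -B + y * A) / R
  have hy0 : (y : L) ≠ 0 := by exact_mod_cast hy
  have hG120 : (q : L) * (G₁ * G₂) ≠ 0 := by
    rw [hG12]; exact mul_ne_zero (mul_ne_zero two_ne_zero hy0) hA0
  have hG10 : G₁ ≠ 0 := left_ne_zero_of_mul (right_ne_zero_of_mul hG120)
  have hG1s : G₁ ^ 2 = 2 * (x + z * B) / q := by field_simp; linear_combination hG1
  have hG2s : G₂ ^ 2 = 2 * (x - z * B) / q := by field_simp; linear_combination hG2
  have hσ1 : σ G₁ = G₁ ∨ σ G₁ = -G₁ := map_eq_of_sq_map_eq (σ := (σ : L →+* L)) (by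
    rw [hG1s]; simp [hσB, map_ofNat σ])
  have hσ2 : σ G₂ = G₂ ∨ σ G₂ = -G₂ := map_eq_of_sq_map_eq (σ := (σ : L →+* L)) (by
    rw [hG2s]; simp [hσB, map_ofNat σ])
  have hτ1 : τ⁻¹ G₁ = G₂ ∨ τ⁻¹ G₁ = -G₂ := by
    refine sq_eq_sq_iff_eq_or_eq_neg.mp ?_
    rw [← map_pow, hG1s, hG2s]
    simp only [map_div₀, map_mul, map_add, map_ofNat, map_ratCast, hτi]
    ring
  -- As qG₁G₂ = 2yA, σ negates exactly one of G₁, G₂. Since τ⁻¹ and τ exchange them up to a common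
  -- sign, ρG₁ picks up the product of both signs of σ, namely -1.
  have hσ12 : σ G₁ * σ G₂ = -(G₁ * G₂) := by
    have := congrArg σ hG12
    simp only [map_mul, hσA, map_ofNat, map_ratCast] at this
    refine mul_left_cancel₀ hq0 ?_
    linear_combination this + hG12
  have hτ2 : (τ⁻¹ G₁ = G₂ ∧ τ G₂ = G₁) ∨ (τ⁻¹ G₁ = -G₂ ∧ τ G₂ = -G₁) := by
    rcases hτ1 with h | h
    · refine .inl ⟨h, ?_⟩
      rw [← h, ← AlgEquiv.mul_apply, mul_inv_cancel, AlgEquiv.one_apply]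
    · refine .inr ⟨h, ?_⟩
      rw [eq_neg_iff_add_eq_zero, add_comm] at h
      rw [eq_neg_of_add_eq_zero_left h, map_neg, ← AlgEquiv.mul_apply, mul_inv_cancel, AlgEquiv.one_apply]
  have hfin := hρ1 G₁
  have hne : G₁ * G₂ ≠ -(G₁ * G₂) := fun h => right_ne_zero_of_mul hG120 (self_eq_neg.mp h)
  have hne1 : -G₁ ≠ G₁ := fun h => hG10 (neg_eq_self.mp h)
  simp only [hρ, AlgEquiv.mul_apply] at hfin
  rcases hσ1 with h1 | h1 <;> rcases hσ2 with h2 | h2 <;>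
    simp only [h1, h2, neg_mul, mul_neg, neg_neg] at hσ12 <;> try exact hne hσ12
  all_goals
    rcases hτ2 with ⟨h3, h4⟩ | ⟨h3, h4⟩ <;> simp [h1, h2, h3, h4] at hfin
    all_goals exact hne1 hfin

/-- If inertia at `2` fixes `√r` whenever it fixes `√a`, then `r` or `ra` is a square
modulo `4` up to squares. -/
theorem isFourPowMulOneMod_or_of_inert [IsGalois ℚ L] {P : Ideal (𝓞 L)} [hP : P.IsPrime]
    (h2 : (2 : 𝓞 L) ∈ P) {A S : L} {a r : ℤ} (hA : A ^ 2 = a) (hS : S ^ 2 = r) (ha0 : a ≠ 0)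
    (hr0 : r ≠ 0) (h : ∀ σ : L ≃ₐ[ℚ] L, IsInert P (σ : L →+* L) → σ A = A → σ S = S) :
    IsFourPowMulOneMod r ∨ IsFourPowMulOneMod (r * a) := by
  by_contra! hcon
  have hne {x : L} {n : ℤ} (hx : x ^ 2 = n) (hn : n ≠ 0) : x ≠ -x := by
    intro h
    have : x = 0 := self_eq_neg.mp h
    rw [this] at hx
    exact hn (by exact_mod_cast (by simpa using hx.symm : (n : L) = 0))
  -- Take σ₁ negating S and σ₂ negating SA. The hypothesis forces both to negate A, so σ₂ fixes S;
  -- then σ₁σ₂ fixes A and negates S.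
  obtain ⟨σ₁, h1, h1S⟩ := exists_inert_neg_of_not_isFourPowMulOneMod h2 hS hr0 hcon.1
  obtain ⟨σ₂, h2', h2S⟩ := exists_inert_neg_of_not_isFourPowMulOneMod h2 (s := S * A) (c := r * a)
    (by rw [mul_pow, hA, hS]; push_cast; rfl) (mul_ne_zero hr0 ha0) hcon.2
  have hsign (σ : L ≃ₐ[ℚ] L) : σ A = A ∨ σ A = -A :=
    map_eq_of_sq_map_eq (σ := (σ : L →+* L)) (by rw [hA]; simp)
  have h1A : σ₁ A = -A := (hsign σ₁).resolve_left fun h' =>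
    hne hS hr0 ((h σ₁ h1 h').symm.trans h1S)
  have hS0 : S ≠ 0 := fun h => hne hS hr0 (by rw [h, neg_zero])
  have hA0 : A ≠ 0 := fun h => hne hA ha0 (by rw [h, neg_zero])
  have h2A : σ₂ A = -A := by
    refine (hsign σ₂).resolve_left fun h' => ?_
    have h3 := h σ₂ h2' h'
    rw [map_mul, h3, h', self_eq_neg] at h2S
    exact mul_ne_zero hS0 hA0 h2S
  have h2S' : σ₂ S = S := by
    rw [map_mul, h2A] at h2S
    refine mul_right_cancel₀ hA0 ?_
    linear_combination -h2S
  have h12 : IsInert P ((σ₁ * σ₂ : L ≃ₐ[ℚ] L) : L →+* L) := by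
    rw [isInert_iff_mem_inertia] at *
    exact mul_mem h1 h2'
  have h3 := h (σ₁ * σ₂) h12 (by rw [AlgEquiv.mul_apply, h2A, map_neg, h1A, neg_neg])
  rw [AlgEquiv.mul_apply, h2S', h1S] at h3
  exact hne hS hr0 h3.symm

end Criteria

end RedeiField

namespace RedeiField

/-! ### The ring of integers and discriminant of ℚ(√c). -/

section Discriminant

theorem discr_of_basis_one_root {S : Type*} [CommRing S] (b : Module.Basis (Fin 2) ℤ S)
    (h0 : b 0 = 1) {T N : ℤ} (h1 : b 1 ^ 2 = T * b 1 - N) :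
    Algebra.discr ℤ b = T ^ 2 - 4 * N := by
  have htr1 : Algebra.trace ℤ S 1 = 2 := by
    have : Module.Free ℤ S := Module.Free.of_basis b
    have h := Algebra.trace_algebraMap_of_basis b (1 : ℤ)
    simpa using h
  have htrω : Algebra.trace ℤ S (b 1) = T := by
    rw [Algebra.trace_eq_matrix_trace b, Matrix.trace_fin_two, Algebra.leftMulMatrix_eq_repr_mul,
      Algebra.leftMulMatrix_eq_repr_mul, h0, mul_one, ← pow_two, h1]
    have h2 : (T : S) * b 1 - N = T • b 1 - N • b 0 := by simp [h0]
    rw [h2, map_sub, map_smul, map_smul, b.repr_self, b.repr_self]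
    simp
  have htr2 : Algebra.trace ℤ S (b 1 * b 1) = T ^ 2 - 2 * N := by
    have h2 : b 1 * b 1 = T • b 1 - N • (1 : S) := by
      rw [← pow_two, h1]; simp
    rw [h2, map_sub, map_smul, map_smul, htr1, htrω]
    simp; ring
  rw [Algebra.discr_def, Matrix.det_fin_two]
  simp only [Algebra.traceMatrix_apply, Algebra.traceForm_apply, h0, one_mul, mul_one, htr1, htrω,
    htr2]
  ring

/-- In lowest terms, the square of the denominator of q divides c, so the denominator is 1. -/
theorem exists_int_of_squarefree_mul_sq {c : ℤ} (hc : Squarefree c) {q : ℚ} {i : ℤ}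
    (h : c * q ^ 2 = i) : ∃ n : ℤ, q = n := by
  have hd : (q.den : ℚ) ≠ 0 := by exact_mod_cast q.den_nz
  have h1 : c * q.num ^ 2 = i * (q.den : ℤ) ^ 2 := by
    have h2 : (c : ℚ) * q.num ^ 2 = i * (q.den : ℚ) ^ 2 := by
      rw [← h]
      nth_rewrite 2 [← Rat.num_div_den q]
      field_simp
    exact_mod_cast h2
  have hcop : IsCoprime ((q.den : ℤ) ^ 2) (q.num ^ 2) :=
    (Int.isCoprime_iff_gcd_eq_one.mpr (by simpa [Int.gcd, Nat.Coprime] using q.reduced.symm)).pow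
  have h3 : (q.den : ℤ) ^ 2 ∣ c := hcop.dvd_of_dvd_mul_right ⟨i, by rw [h1]; ring⟩
  have h4 := hc (q.den : ℤ) (by rwa [← pow_two])
  have h5 : q.den = 1 := by
    rw [Int.ofNat_isUnit] at h4
    exact Nat.isUnit_iff.mp h4
  exact ⟨q.num, by rw [← Rat.den_eq_one_iff q |>.mp h5]; simp⟩

variable {K : Type*} [Field K] [NumberField K]

/-- The trace 2u and the norm u² - cv² of an integral element are integers, and then c(2v)² is one
too. -/
theorem exists_int_trace_norm {c : ℤ} (hc : Squarefree c) (hc1 : c ≠ 1) {s : K} (hs : s ^ 2 = c)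
    (hspan : ∀ x : K, ∃ u v : ℚ, x = u + v * s) {u v : ℚ} {x : 𝓞 K} (hx : algebraMap (𝓞 K) K x = u + v * s) :
    ∃ m n k : ℤ, 2 * u = m ∧ 2 * v = n ∧ m ^ 2 - c * n ^ 2 = 4 * k := by
  have hint : IsIntegral ℤ ((u : K) + v * s) := hx ▸ x.2
  have hli : LinearIndependent ℚ ![(1 : K), s] := by
    rw [LinearIndependent.pair_iff]
    intro p q h
    by_contra hpq
    rw [not_and_or] at hpq
    refine add_mul_sqrt_ne_zero hc hc1 hs hpq ?_
    rw [← h]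
    simp [Rat.smul_def]
  have hsp : ⊤ ≤ Submodule.span ℚ (Set.range ![(1 : K), s]) := by
    rintro x -
    obtain ⟨p, q, rfl⟩ := hspan x
    rw [Matrix.range_cons, Matrix.range_cons, Matrix.range_empty, Set.union_empty,
      Set.singleton_union, Submodule.mem_span_pair]
    exact ⟨p, q, by simp [Rat.smul_def]⟩
  let b := Module.Basis.mk hli hsp
  have hb0 : b 0 = 1 := by simp [b]
  have hb1 : b 1 = s := by simp [b]
  have hrepr (p q : ℚ) : b.repr ((p : K) + q * s) = Finsupp.single 0 p + Finsupp.single 1 q := by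
    have : (p : K) + q * s = p • b 0 + q • b 1 := by simp [hb0, hb1, Rat.smul_def]
    rw [this, map_add, map_smul, map_smul, b.repr_self, b.repr_self]
    simp
  have hmul : ((u : K) + v * s) * s = ((c * v : ℚ) : K) + u * s := by
    push_cast; linear_combination v * hs
  have htr : Algebra.trace ℚ K ((u : K) + v * s) = 2 * u := by
    rw [Algebra.trace_eq_matrix_trace b, Matrix.trace_fin_two, Algebra.leftMulMatrix_eq_repr_mul,
      Algebra.leftMulMatrix_eq_repr_mul, hb0, hb1, mul_one, hmul, hrepr, hrepr]
    simp; ring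
  have hno : Algebra.norm ℚ ((u : K) + v * s) = u ^ 2 - c * v ^ 2 := by
    rw [Algebra.norm_eq_matrix_det b, Matrix.det_fin_two]
    simp only [Algebra.leftMulMatrix_eq_repr_mul, hb0, hb1, mul_one, hmul, hrepr]
    simp; ring
  obtain ⟨m, hm⟩ := IsIntegrallyClosed.isIntegral_iff.mp (htr ▸ Algebra.isIntegral_trace hint :
    IsIntegral ℤ (2 * u))
  obtain ⟨k, hk⟩ := IsIntegrallyClosed.isIntegral_iff.mp (hno ▸ Algebra.isIntegral_norm ℚ hint :
    IsIntegral ℤ (u ^ 2 - c * v ^ 2))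
  rw [eq_intCast] at hm hk
  have h1 : c * (2 * v) ^ 2 = ((m ^ 2 - 4 * k : ℤ) : ℚ) := by
    push_cast; rw [hm, hk]; ring
  obtain ⟨n, hn⟩ := exists_int_of_squarefree_mul_sq hc h1
  refine ⟨m, n, k, hm.symm, hn, ?_⟩
  rw [hn] at h1
  have h2 : c * n ^ 2 = m ^ 2 - 4 * k := by exact_mod_cast h1
  linarith

theorem discr_eq_of_root {c : ℤ} (hc : Squarefree c) (hc1 : c ≠ 1) {s : K} (hs : s ^ 2 = c)
    {ω : 𝓞 K} {T N : ℤ} (hω : ω ^ 2 = T * ω - N) {e f : ℚ} (hf : f ≠ 0)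
    (hωs : algebraMap (𝓞 K) K ω = e + f * s)
    (hspan : ∀ x : 𝓞 K, ∃ i j : ℤ, x = i + j * ω) : discr K = T ^ 2 - 4 * N := by
  have hli : LinearIndependent ℤ ![(1 : 𝓞 K), ω] := by
    rw [LinearIndependent.pair_iff]
    intro p q h
    have h1 : ((p + q * e : ℚ) : K) + ((q * f : ℚ) : K) * s = 0 := by
      have := congrArg (algebraMap (𝓞 K) K) h
      simp [hωs] at this
      push_cast
      linear_combination this
    by_contra hpq
    refine add_mul_sqrt_ne_zero hc hc1 hs ?_ h1
    by_cases hq : q = 0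
    · left
      subst hq
      simp at hpq ⊢
      exact hpq
    · right
      exact mul_ne_zero (by exact_mod_cast hq) hf
  have hsp : ⊤ ≤ Submodule.span ℤ (Set.range ![(1 : 𝓞 K), ω]) := by
    rintro x -
    obtain ⟨p, q, rfl⟩ := hspan x
    rw [Matrix.range_cons, Matrix.range_cons, Matrix.range_empty, Set.union_empty,
      Set.singleton_union, Submodule.mem_span_pair]
    exact ⟨p, q, by simp⟩
  let b := Module.Basis.mk hli hsp
  rw [← discr_eq_discr K b]
  exact discr_of_basis_one_root b (by simp [b]) (by simpa [b] using hω)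

theorem exists_eq_add_mul_of_mem_sqrtField {c : ℤ} (hc : Squarefree c) (hc1 : c ≠ 1) {s : ℂ}
    (hs : s ^ 2 = c) {x : ℂ} (hx : x ∈ sqrtField c) : ∃ u v : ℚ, x = u + v * s := by
  induction hx using IntermediateField.adjoin_induction with
  | mem x hx =>
    rcases sq_eq_sq_iff_eq_or_eq_neg.mp (hx.trans hs.symm) with rfl | rfl
    · exact ⟨0, 1, by simp⟩
    · exact ⟨0, -1, by simp⟩
  | algebraMap q => exact ⟨q, 0, by simp⟩
  | add x y _ _ hx hy =>
    obtain ⟨u, v, rfl⟩ := hx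
    obtain ⟨p, q, rfl⟩ := hy
    exact ⟨u + p, v + q, by push_cast; ring⟩
  | inv x _ hx =>
    obtain ⟨u, v, rfl⟩ := hx
    by_cases h : u ≠ 0 ∨ v ≠ 0
    · have h1 := add_mul_sqrt_ne_zero hc hc1 hs h
      have h2 := add_mul_sqrt_ne_zero hc hc1 (s := -s) (by rwa [neg_sq]) h
      refine ⟨u / (u ^ 2 - c * v ^ 2), -v / (u ^ 2 - c * v ^ 2), ?_⟩
      have h3 : (u : ℂ) ^ 2 - c * v ^ 2 = (u + v * s) * (u + v * -s) := by
        linear_combination v ^ 2 * hs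
      push_cast
      rw [h3, div_mul_eq_mul_div, ← add_div, eq_div_iff (mul_ne_zero h1 h2), inv_mul_cancel_left₀ h1]
      ring
    · push Not at h
      exact ⟨0, 0, by simp [h.1, h.2]⟩
  | mul x y _ _ hx hy =>
    obtain ⟨u, v, rfl⟩ := hx
    obtain ⟨p, q, rfl⟩ := hy
    exact ⟨u * p + c * v * q, u * q + v * p, by push_cast; linear_combination v * q * hs⟩

theorem mem_sqrtField {c : ℤ} {s : ℂ} (hs : s ^ 2 = c) : s ∈ sqrtField c :=
  IntermediateField.subset_adjoin ℚ _ hs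

theorem exists_complex_sqrt (c : ℂ) : ∃ s : ℂ, s ^ 2 = c := IsAlgClosed.exists_pow_nat_eq c two_pos

theorem exists_sqrt_sqrtField {c : ℤ} (hc : Squarefree c) (hc1 : c ≠ 1) :
    ∃ s : sqrtField c, s ^ 2 = c ∧ ∀ x : sqrtField c, ∃ u v : ℚ, x = u + v * s := by
  obtain ⟨s, hs⟩ := exists_complex_sqrt c
  refine ⟨⟨s, mem_sqrtField hs⟩, Subtype.ext (by simpa using hs), fun x => ?_⟩
  obtain ⟨u, v, h⟩ := exists_eq_add_mul_of_mem_sqrtField hc hc1 hs x.2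
  exact ⟨u, v, Subtype.ext (by simpa using h)⟩

theorem Δ_of_mod_four_eq_one {c : ℤ} (hc : Squarefree c) (hc1 : c ≠ 1) (h : c % 4 = 1) :
    Δ c = c := by
  obtain ⟨s, hs, hspan⟩ := exists_sqrt_sqrtField hc hc1
  obtain ⟨ω, hω⟩ := exists_integer_half hs h
  obtain ⟨k, rfl⟩ : ∃ k, c = 4 * k + 1 := ⟨c / 4, by omega⟩
  have hω' : algebraMap (𝓞 (sqrtField (4 * k + 1))) (sqrtField (4 * k + 1)) ω = (1 + s) / 2 := by
    rw [hω]; ring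
  rw [Δ, discr_eq_of_root hc hc1 hs (ω := ω) (T := 1) (N := -k) (e := 1 / 2) (f := 1 / 2) ?_ (by norm_num)
    (by rw [hω']; push_cast; ring) ?_]
  · ring
  · apply ringOfIntegers_ext
    push_cast at hs
    simp only [map_sub, map_pow, map_mul, map_intCast, hω']
    push_cast
    linear_combination hs / 4
  · intro x
    obtain ⟨u, v, hx⟩ := hspan x
    obtain ⟨m, n, l, hm, hn, hl⟩ := exists_int_trace_norm hc hc1 hs hspan hx
    -- m² ≡ cn² mod 4 with c ≡ 1 mod 4 forces equal parities, which is what the basis 1, (1 + √c)/2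
    -- requires.
    have hpar : (m - n) % 2 = 0 := by
      rcases Int.emod_two_eq_zero_or_one m with h1 | h1 <;>
      rcases Int.emod_two_eq_zero_or_one n with h2 | h2
      · omega
      · exfalso
        obtain ⟨m, rfl⟩ : ∃ m', m = 2 * m' := ⟨m / 2, by omega⟩
        obtain ⟨n, rfl⟩ : ∃ n', n = 2 * n' + 1 := ⟨n / 2, by omega⟩
        ring_nf at hl; omega
      · exfalso
        obtain ⟨m, rfl⟩ : ∃ m', m = 2 * m' + 1 := ⟨m / 2, by omega⟩
        obtain ⟨n, rfl⟩ : ∃ n', n = 2 * n' := ⟨n / 2, by omega⟩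
        ring_nf at hl; omega
      · omega
    obtain ⟨i, rfl⟩ : ∃ i, m = n + 2 * i := ⟨(m - n) / 2, by omega⟩
    refine ⟨i, n, ringOfIntegers_ext ?_⟩
    have hu : u = (n + 2 * i) / 2 := by push_cast at hm; linarith
    have hv : v = n / 2 := by linarith
    change (x : sqrtField (4 * k + 1)) = _
    rw [hx, hu, hv]
    simp [hω']
    ring

theorem Δ_of_mod_four_ne_one {c : ℤ} (hc : Squarefree c) (hc1 : c ≠ 1) (h : c % 4 ≠ 1) :
    Δ c = 4 * c := by
  obtain ⟨s, hs, hspan⟩ := exists_sqrt_sqrtField hc hc1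
  have h4 : c % 4 = 2 ∨ c % 4 = 3 := by
    have : c % 4 ≠ 0 := by
      intro h0
      have := hc 2 (by omega)
      exact absurd this (by decide)
    omega
  obtain ⟨ω, rfl, hω⟩ := exists_integer_of_sq_eq (u := (c : 𝓞 (sqrtField c))) (by simpa using hs)
  rw [Δ, discr_eq_of_root hc hc1 hs (ω := ω) (T := 0) (N := -c) (e := 0) (f := 1) ?_ one_ne_zero
    (by simp) ?_]
  · ring
  · rw [hω]; simp
  · intro x
    obtain ⟨u, v, hx⟩ := hspan x
    obtain ⟨m, n, l, hm, hn, hl⟩ := exists_int_trace_norm hc hc1 hs hspan hx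
    have hpar : m % 2 = 0 ∧ n % 2 = 0 := by
      obtain ⟨d, r, rfl, hr⟩ : ∃ d r, c = 4 * d + r ∧ (r = 2 ∨ r = 3) :=
        ⟨c / 4, c % 4, by omega, h4⟩
      rcases Int.emod_two_eq_zero_or_one m with h1 | h1 <;>
      rcases Int.emod_two_eq_zero_or_one n with h2 | h2
      · omega
      all_goals
        exfalso
        obtain ⟨m', hm'⟩ : ∃ m', m = 2 * m' + m % 2 := ⟨m / 2, by omega⟩
        obtain ⟨n', hn'⟩ : ∃ n', n = 2 * n' + n % 2 := ⟨n / 2, by omega⟩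
        rw [h1] at hm'
        rw [h2] at hn'
        subst hm' hn'
        rcases hr with rfl | rfl <;> ring_nf at hl <;> omega
    obtain ⟨i, rfl⟩ : ∃ i, m = 2 * i := ⟨m / 2, by omega⟩
    obtain ⟨j, rfl⟩ : ∃ j, n = 2 * j := ⟨n / 2, by omega⟩
    refine ⟨i, j, ringOfIntegers_ext ?_⟩
    have hu : u = i := by push_cast at hm; linarith
    have hv : v = j := by push_cast at hn; linarith
    change (x : sqrtField c) = _
    rw [hx, hu, hv]
    simp

end Discriminant

end RedeiField

namespace RedeiField

/-! ### The fields F_t: generators and Galois property over ℚ. -/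

section Twist

variable {a b : ℤ} {α β ρ : ℂ} {x y z t : ℚ}

theorem mem_biquadField_left (hα : α ^ 2 = a) : α ∈ biquadField a b :=
  (le_sup_left : sqrtField a ≤ _) (mem_sqrtField hα)

theorem mem_biquadField_right (hβ : β ^ 2 = b) : β ∈ biquadField a b :=
  (le_sup_right : sqrtField b ≤ _) (mem_sqrtField hβ)

theorem mem_twist_left (hα : α ^ 2 = a) : α ∈ twist a b α x y t :=
  (le_sup_left : biquadField a b ≤ _) (mem_biquadField_left hα)

theorem mem_twist_right (hβ : β ^ 2 = b) : β ∈ twist a b α x y t :=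
  (le_sup_left : biquadField a b ≤ _) (mem_biquadField_right hβ)

theorem mem_twist (hρ : ρ ^ 2 = t * (x + y * α)) : ρ ∈ twist a b α x y t := by
  refine (le_sup_right : _ ≤ twist a b α x y t) (IntermediateField.subset_adjoin ℚ _ ?_)
  change ρ ^ 2 = _
  rw [hρ]; push_cast; ring

theorem adjoin_le_of_sq_eq {c s : ℂ} {F : IntermediateField ℚ ℂ} (hs : s ^ 2 = c) (h : s ∈ F) :
    IntermediateField.adjoin ℚ {w : ℂ | w ^ 2 = c} ≤ F := by
  refine IntermediateField.adjoin_le_iff.mpr fun w hw => ?_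
  rcases sq_eq_sq_iff_eq_or_eq_neg.mp ((hw : w ^ 2 = c).trans hs.symm) with rfl | rfl
  · exact h
  · exact neg_mem h

theorem twist_le {F : IntermediateField ℚ ℂ} (hα : α ^ 2 = a) (hβ : β ^ 2 = b)
    (hρ : ρ ^ 2 = t * (x + y * α)) (h1 : α ∈ F) (h2 : β ∈ F) (h3 : ρ ∈ F) :
    twist a b α x y t ≤ F :=
  sup_le (sup_le (adjoin_le_of_sq_eq hα h1) (adjoin_le_of_sq_eq hβ h2))
    (adjoin_le_of_sq_eq (by rw [hρ]; push_cast; ring) h3)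

theorem twist_eq_adjoin (hα : α ^ 2 = a) (hβ : β ^ 2 = b) (hρ : ρ ^ 2 = t * (x + y * α)) :
    twist a b α x y t = IntermediateField.adjoin ℚ {α, β, ρ} := by
  refine le_antisymm (twist_le hα hβ hρ ?_ ?_ ?_) (IntermediateField.adjoin_le_iff.mpr ?_)
  · exact IntermediateField.subset_adjoin ℚ _ (by simp)
  · exact IntermediateField.subset_adjoin ℚ _ (by simp)
  · exact IntermediateField.subset_adjoin ℚ _ (by simp)
  · rintro w (rfl | rfl | rfl)
    exacts [mem_twist_left hα, mem_twist_right hβ, mem_twist hρ]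

theorem map_eq_of_mem_adjoin {G : IntermediateField ℚ ℂ} {S : Set ℂ}
    (hS : IntermediateField.adjoin ℚ S ≤ G) (σ : G →+* G)
    (h : ∀ w ∈ S, ∀ hw : w ∈ G, σ ⟨w, hw⟩ = ⟨w, hw⟩) {w : ℂ}
    (hw : w ∈ IntermediateField.adjoin ℚ S) (hwG : w ∈ G) : σ ⟨w, hwG⟩ = ⟨w, hwG⟩ := by
  revert hwG
  induction hw using IntermediateField.adjoin_induction with
  | mem w hw => exact h w hw
  | algebraMap q => exact fun _ => map_ratCast σ q
  | add v w hv hw ihv ihw =>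
    intro _
    have := congrArg₂ (· + ·) (ihv (hS hv)) (ihw (hS hw))
    rwa [← map_add] at this
  | inv w hw ih =>
    intro _
    have := congrArg (·⁻¹) (ih (hS hw))
    rwa [← map_inv₀] at this
  | mul v w hv hw ihv ihw =>
    intro _
    have := congrArg₂ (· * ·) (ihv (hS hv)) (ihw (hS hw))
    rwa [← map_mul] at this

theorem map_eq_of_mem_sqrtField {G : IntermediateField ℚ ℂ} {c : ℤ} (hc : sqrtField c ≤ G)
    (σ : G →+* G) {s : ℂ} (hs : s ^ 2 = c) (hsG : s ∈ G) (h : σ ⟨s, hsG⟩ = ⟨s, hsG⟩) {w : ℂ}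
    (hw : w ∈ sqrtField c) : σ ⟨w, hc hw⟩ = ⟨w, hc hw⟩ := by
  refine map_eq_of_mem_adjoin hc σ (fun w hw hwG => ?_) hw (hc hw)
  rcases sq_eq_sq_iff_eq_or_eq_neg.mp ((hw : w ^ 2 = c).trans hs.symm) with rfl | rfl
  · exact h
  · have : (⟨-s, hwG⟩ : G) = -⟨s, hsG⟩ := rfl
    rw [this, map_neg, h]

theorem exists_twist_generators (hα : α ^ 2 = a) (hβ : β ^ 2 = b)
    (hβ0 : (t : ℂ) * (x + y * α) ≠ 0) :
    ∃ A B R : twist a b α x y t, A ^ 2 = a ∧ B ^ 2 = b ∧ R ^ 2 = t * (x + y * A) ∧ R ≠ 0 ∧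
      (A : ℂ) = α ∧ (B : ℂ) = β ∧ ∀ σ : twist a b α x y t →+* twist a b α x y t,
      σ A = A → σ B = B → σ R = R → ∀ u, σ u = u := by
  obtain ⟨ρ, hρ⟩ := exists_complex_sqrt ((t : ℂ) * (x + y * α))
  have hρ0 : ρ ≠ 0 := by rintro rfl; exact hβ0 (by rw [← hρ]; simp)
  refine ⟨⟨α, mem_twist_left hα⟩, ⟨β, mem_twist_right hβ⟩, ⟨ρ, mem_twist hρ⟩,
    Subtype.ext (by simpa using hα), Subtype.ext (by simpa using hβ),
    Subtype.ext (by simpa using hρ), fun h => hρ0 (congrArg Subtype.val h), rfl, rfl, ?_⟩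
  intro σ h1 h2 h3 u
  have h := twist_eq_adjoin hα hβ hρ
  refine map_eq_of_mem_adjoin h.ge σ ?_ (h ▸ u.2) u.2
  rintro w (rfl | rfl | rfl) _
  exacts [h1, h2, h3]

-- F_t is the splitting field of (X² - a)(X² - b)((X² - tx)² - a(ty)²), hence Galois over ℚ.
open Polynomial in
theorem exists_twist_eq_adjoin_rootSet (hα : α ^ 2 = a)
    (heq : x ^ 2 - a * y ^ 2 = b * z ^ 2) (hβ0 : (t : ℂ) * (x + y * α) ≠ 0) :
    ∃ p : ℚ[X], p ≠ 0 ∧ twist a b α x y t = IntermediateField.adjoin ℚ (p.rootSet ℂ) := by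
  obtain ⟨β, hβ⟩ := exists_complex_sqrt (b : ℂ)
  obtain ⟨ρ, hρ⟩ := exists_complex_sqrt ((t : ℂ) * (x + y * α))
  have hρ0 : ρ ≠ 0 := by rintro rfl; exact hβ0 (by rw [← hρ]; simp)
  let p : ℚ[X] := (X ^ 2 - C (a : ℚ)) * (X ^ 2 - C (b : ℚ)) *
    ((X ^ 2 - C (t * x)) ^ 2 - C (a * (t * y) ^ 2))
  have hmonic : p.Monic := by
    refine Monic.mul (Monic.mul (by monicity!) (by monicity!)) ?_
    monicity!
  have hroot (w : ℂ) : w ∈ p.rootSet ℂ ↔ (w ^ 2 - a) * (w ^ 2 - b) *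
      ((w ^ 2 - t * x) ^ 2 - a * (t * y) ^ 2) = 0 := by
    rw [mem_rootSet, and_iff_right hmonic.ne_zero]
    simp only [p, map_mul, map_sub, map_pow, aeval_X, aeval_C]
    simp
  have heq' : (x : ℂ) ^ 2 - a * y ^ 2 = b * z ^ 2 := by exact_mod_cast heq
  refine ⟨p, hmonic.ne_zero, le_antisymm (twist_le hα hβ hρ ?_ ?_ ?_)
    (IntermediateField.adjoin_le_iff.mpr ?_)⟩
  · exact IntermediateField.subset_adjoin ℚ _ ((hroot α).mpr (by rw [hα]; ring))
  · exact IntermediateField.subset_adjoin ℚ _ ((hroot β).mpr (by rw [hβ]; ring))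
  · refine IntermediateField.subset_adjoin ℚ _ ((hroot ρ).mpr ?_)
    rw [hρ, ← hα]; ring
  · intro w hw
    have h := (hroot w).mp hw
    have hle {c s : ℂ} (hs : s ∈ twist a b α x y t) (hsc : s ^ 2 = c) (hwc : w ^ 2 - c = 0) :
        w ∈ twist a b α x y t := by
      refine adjoin_le_of_sq_eq hsc hs (IntermediateField.subset_adjoin ℚ _ ?_)
      exact sub_eq_zero.mp hwc
    rcases mul_eq_zero.mp h with h | h
    · rcases mul_eq_zero.mp h with h | h
      · exact hle (mem_twist_left hα) hα h
      · exact hle (mem_twist_right hβ) hβ h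
    · have h' : (w ^ 2 - t * (x + y * α)) * (w ^ 2 - t * (x - y * α)) = 0 := by
        rw [← h, ← hα]; ring
      rcases mul_eq_zero.mp h' with h | h
      · exact hle (mem_twist hρ) hρ h
      -- The conjugate root √(t(x - yα)) is tzβ/ρ, because the product of the two radicands is
      -- t²bz².
      · refine hle (s := t * z * β / ρ) ?_ ?_ h
        · exact div_mem (mul_mem (mul_mem (SubfieldClass.ratCast_mem _ t) (SubfieldClass.ratCast_mem _ z))
            (mem_twist_right hβ)) (mem_twist hρ)
        · rw [div_pow, hρ, div_eq_iff hβ0, mul_pow, hβ]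
          linear_combination -t ^ 2 * heq' + (t : ℂ) ^ 2 * y ^ 2 * hα

theorem numberField_and_isGalois_of_eq_adjoin_rootSet {F : IntermediateField ℚ ℂ}
    {p : Polynomial ℚ} (h : F = IntermediateField.adjoin ℚ (p.rootSet ℂ)) :
    NumberField F ∧ IsGalois ℚ F := by
  subst h
  have hs : p.IsSplittingField ℚ (IntermediateField.adjoin ℚ (p.rootSet ℂ)) := by
    convert IntermediateField.adjoin_rootSet_isSplittingField (K := ℚ) (L := ℂ) (p := p)
      (IsAlgClosed.splits _)
    exact Subsingleton.elim _ _
  have := Polynomial.IsSplittingField.finiteDimensional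
    (IntermediateField.adjoin ℚ (p.rootSet ℂ)) p
  have := Normal.of_isSplittingField (E := IntermediateField.adjoin ℚ (p.rootSet ℂ)) p
  exact ⟨⟨⟩, ⟨⟩⟩

theorem numberField_and_isGalois_twist (hα : α ^ 2 = a)
    (heq : x ^ 2 - a * y ^ 2 = b * z ^ 2) (hβ0 : (t : ℂ) * (x + y * α) ≠ 0) :
    NumberField (twist a b α x y t) ∧ IsGalois ℚ (twist a b α x y t) := by
  obtain ⟨p, -, h⟩ := exists_twist_eq_adjoin_rootSet hα heq hβ0
  exact numberField_and_isGalois_of_eq_adjoin_rootSet h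

/-- The compositum is where two twists are compared, since it contains √(tt'). -/
theorem numberField_and_isGalois_twist_sup {t' : ℚ} (hα : α ^ 2 = a)
    (heq : x ^ 2 - a * y ^ 2 = b * z ^ 2) (hβ0 : (t : ℂ) * (x + y * α) ≠ 0)
    (hβ0' : (t' : ℂ) * (x + y * α) ≠ 0) :
    NumberField ↥(twist a b α x y t ⊔ twist a b α x y t') ∧
      IsGalois ℚ ↥(twist a b α x y t ⊔ twist a b α x y t') := by
  obtain ⟨p, hp, h⟩ := exists_twist_eq_adjoin_rootSet hα heq hβ0
  obtain ⟨q, hq, h'⟩ := exists_twist_eq_adjoin_rootSet hα heq hβ0'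
  refine numberField_and_isGalois_of_eq_adjoin_rootSet (p := p * q) ?_
  have hpq : (p * q).rootSet ℂ = p.rootSet ℂ ∪ q.rootSet ℂ := by
    ext w
    simp [Polynomial.mem_rootSet, hp, hq]
  rw [h, h', hpq, IntermediateField.adjoin_union]

end Twist

/-! ### Rescaling a solution to p-primitive integers. -/

section Primitive

/-- A square scalar q² does not change F, so the scalar matters only through the parity of its
p-adic valuation, recorded by r ∈ {1, p}. -/
theorem exists_primitive_multiple {p : ℕ} (hp : p.Prime) {x y z : ℚ} (h : (x, y, z) ≠ (0, 0, 0)) :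
    ∃ (q : ℚ) (r X Y Z : ℤ), q ≠ 0 ∧ (r = 1 ∨ r = p) ∧ x = q ^ 2 * r * X ∧ y = q ^ 2 * r * Y ∧
      z = q ^ 2 * r * Z ∧ ¬ ((p : ℤ) ∣ X ∧ (p : ℤ) ∣ Y ∧ (p : ℤ) ∣ Z) := by
  have hden (v : ℚ) : (v.den : ℚ) ≠ 0 := by exact_mod_cast v.den_nz
  have hnum (v : ℚ) : v = v.num / v.den := (Rat.num_div_den v).symm
  set D : ℚ := x.den * y.den * z.den with hD
  have hD0 : D ≠ 0 := mul_ne_zero (mul_ne_zero (hden x) (hden y)) (hden z)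
  have hx := hden x
  have hy := hden y
  have hz := hden z
  obtain ⟨X, Y, Z, hX, hY, hZ⟩ : ∃ X Y Z : ℤ, x = (1 / D) ^ 2 * X ∧ y = (1 / D) ^ 2 * Y ∧
      z = (1 / D) ^ 2 * Z := by
    have key (v : ℚ) (d : ℤ) (hd : D = v.den * d) : ∃ V : ℤ, v = (1 / D) ^ 2 * V := by
      -- The denominator is cleared by the square D², with D = v.den·d, so that the scalar stays a
      -- square.
      refine ⟨v.num * d * (d * v.den), ?_⟩
      have hv := hden v
      have hd0 : (d : ℚ) ≠ 0 := by intro h; rw [h, mul_zero] at hd; exact hD0 hd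
      push_cast
      rw [hd]
      field_simp
      exact_mod_cast Rat.mul_den_eq_num v
    obtain ⟨X, hX⟩ := key x (y.den * z.den) (by push_cast; rw [hD]; ring)
    obtain ⟨Y, hY⟩ := key y (x.den * z.den) (by push_cast; rw [hD]; ring)
    obtain ⟨Z, hZ⟩ := key z (x.den * y.den) (by push_cast; rw [hD]; ring)
    exact ⟨X, Y, Z, hX, hY, hZ⟩
  have hg0 : Int.gcd X (Int.gcd Y Z) ≠ 0 := by
    intro hg
    simp only [Int.gcd_eq_zero_iff, Int.natCast_eq_zero] at hg
    obtain ⟨rfl, rfl, rfl⟩ := hg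
    exact h (by simp [hX, hY, hZ])
  obtain ⟨k, m, hm, hg⟩ := Nat.exists_eq_pow_mul_and_not_dvd hg0 p hp.ne_one
  have hpg : (p : ℤ) ^ k ∣ (Int.gcd X (Int.gcd Y Z) : ℕ) := ⟨m, by rw [hg]; push_cast; rfl⟩
  have hgX : (p : ℤ) ^ k ∣ X := hpg.trans (Int.gcd_dvd_left X (Int.gcd Y Z))
  have hgYZ : ((Int.gcd X (Int.gcd Y Z) : ℕ) : ℤ) ∣ Int.gcd Y Z := Int.gcd_dvd_right X (Int.gcd Y Z)
  have hgY : (p : ℤ) ^ k ∣ Y := (hpg.trans hgYZ).trans (Int.gcd_dvd_left Y Z)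
  have hgZ : (p : ℤ) ^ k ∣ Z := (hpg.trans hgYZ).trans (Int.gcd_dvd_right Y Z)
  have hp0 : (p : ℚ) ≠ 0 := by exact_mod_cast hp.ne_zero
  obtain ⟨X, rfl⟩ := hgX
  obtain ⟨Y, rfl⟩ := hgY
  obtain ⟨Z, rfl⟩ := hgZ
  have hprim : ¬ ((p : ℤ) ∣ X ∧ (p : ℤ) ∣ Y ∧ (p : ℤ) ∣ Z) := by
    rintro ⟨h1, h2, h3⟩
    have h4 : (p : ℤ) ^ k * p ∣
        (Int.gcd ((p : ℤ) ^ k * X) (Int.gcd ((p : ℤ) ^ k * Y) ((p : ℤ) ^ k * Z)) : ℕ) :=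
      Int.dvd_coe_gcd (mul_dvd_mul_left _ h1)
        (Int.dvd_coe_gcd (mul_dvd_mul_left _ h2) (mul_dvd_mul_left _ h3))
    rw [hg] at h4
    have h5 : p ^ k * p ∣ p ^ k * m := by exact_mod_cast h4
    exact hm (Nat.dvd_of_mul_dvd_mul_left (pow_pos hp.pos k) h5)
  rcases Nat.even_or_odd' k with ⟨j, rfl | rfl⟩
  · refine ⟨p ^ j / D, 1, X, Y, Z, by positivity, .inl rfl, ?_, ?_, ?_, hprim⟩
    · rw [hX]; push_cast; ring
    · rw [hY]; push_cast; ring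
    · rw [hZ]; push_cast; ring
  · refine ⟨p ^ j / D, p, X, Y, Z, by positivity, .inr rfl, ?_, ?_, ?_, hprim⟩
    · rw [hX]; push_cast; ring
    · rw [hY]; push_cast; ring
    · rw [hZ]; push_cast; ring

end Primitive

end RedeiField

namespace RedeiField

/-! ### Congruences and counting of twists. -/

section Arithmetic

theorem exists_sq_sub_eq_two_pow {b : ℤ} (hb : b % 8 = 1) (N : ℕ) :
    ∃ w c : ℤ, w % 2 = 1 ∧ b - w ^ 2 = 2 ^ (N + 3) * c := by
  induction N with
  | zero => exact ⟨1, b / 8, by norm_num, by norm_num; omega⟩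
  | succ N ih =>
    obtain ⟨w, c, hw, h⟩ := ih
    obtain ⟨v, rfl⟩ : ∃ v, w = 2 * v + 1 := ⟨w / 2, by omega⟩
    rcases Int.even_or_odd' c with ⟨d, rfl | rfl⟩
    · exact ⟨2 * v + 1, d, hw, by rw [h]; ring⟩
    -- Hensel step at 2: adding 2^(N+2) to w changes w² by 2^(N+3) times an odd number modulo
    -- 2^(N+4), which cancels an odd c.
    · refine ⟨2 * v + 1 + 2 ^ (N + 2), d - v - 2 ^ N, by rw [pow_add]; omega, ?_⟩
      ring_nf at h ⊢
      linarith

theorem exists_sq_sub_eq_four_pow {b : ℤ} (hb : b % 8 = 1) (N : ℕ) :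
    ∃ w c : ℤ, w % 2 = 1 ∧ b - w ^ 2 = 4 ^ N * c := by
  obtain ⟨w, c, hw, h⟩ := exists_sq_sub_eq_two_pow hb (2 * N)
  exact ⟨w, 8 * c, hw, by rw [h, pow_add, pow_mul]; norm_num; ring⟩

theorem exists_not_four_pow_dvd {n : ℤ} (hn : n ≠ 0) : ∃ N : ℕ, ¬ (4 : ℤ) ^ N ∣ n := by
  refine ⟨n.natAbs, fun h => ?_⟩
  have h1 := Int.le_of_dvd (abs_pos.mpr hn) ((dvd_abs _ _).mpr h)
  have h2 : n.natAbs < 4 ^ n.natAbs := Nat.lt_pow_self (by norm_num)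
  have h3 : (n.natAbs : ℤ) < 4 ^ n.natAbs := by exact_mod_cast h2
  rw [Int.natCast_natAbs] at h3
  omega

theorem mod_four_cases {a b X Y Z : ℤ} (ha : a % 4 = 1) (hb : b % 4 = 1)
    (heq : X ^ 2 - a * Y ^ 2 = b * Z ^ 2) (hprim : ¬ (2 ∣ X ∧ 2 ∣ Y ∧ 2 ∣ Z)) :
    X % 2 = 1 ∧ ((Y % 2 = 0 ∧ Z % 2 = 1) ∨ (Y % 2 = 1 ∧ Z % 2 = 0)) := by
  obtain ⟨a, rfl⟩ : ∃ k, a = 4 * k + 1 := ⟨a / 4, by omega⟩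
  obtain ⟨b, rfl⟩ : ∃ k, b = 4 * k + 1 := ⟨b / 4, by omega⟩
  rcases Int.even_or_odd' X with ⟨X, rfl | rfl⟩ <;> rcases Int.even_or_odd' Y with ⟨Y, rfl | rfl⟩ <;>
    rcases Int.even_or_odd' Z with ⟨Z, rfl | rfl⟩ <;> ring_nf at heq <;> omega

/-- For a ≡ 2 mod 4, primitivity forces X and Z odd, whence aY² ≡ 1 - 5 ≡ 4 mod 8; but aY² is 0, 2
or 6 mod 8. -/
theorem mod_four_eq_three {a b X Y Z : ℤ} (ha : Squarefree a) (ha' : a % 4 ≠ 1) (hb : b % 8 = 5)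
    (heq : X ^ 2 - a * Y ^ 2 = b * Z ^ 2) (hprim : ¬ (2 ∣ X ∧ 2 ∣ Y ∧ 2 ∣ Z)) : a % 4 = 3 := by
  have h0 : a % 4 ≠ 0 := by
    intro h0
    have := ha 2 (by omega)
    exact absurd this (by decide)
  by_contra h3
  obtain ⟨a, rfl⟩ : ∃ k, a = 4 * k + 2 := ⟨a / 4, by omega⟩
  obtain ⟨b, rfl⟩ : ∃ k, b = 8 * k + 5 := ⟨b / 8, by omega⟩
  have hsq (n : ℤ) : ∃ k, (2 * n + 1) ^ 2 = 8 * k + 1 := by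
    obtain ⟨k, hk⟩ := Int.even_mul_succ_self n
    exact ⟨k, by linear_combination 4 * hk⟩
  rcases Int.even_or_odd' X with ⟨X, rfl | rfl⟩ <;> rcases Int.even_or_odd' Y with ⟨Y, rfl | rfl⟩ <;>
    rcases Int.even_or_odd' Z with ⟨Z, rfl | rfl⟩
  · omega
  · ring_nf at heq; omega
  · ring_nf at heq; omega
  · ring_nf at heq; omega
  · ring_nf at heq; omega
  · obtain ⟨k, hk⟩ := hsq X
    obtain ⟨l, hl⟩ := hsq Z
    rw [hk, hl] at heq
    ring_nf at heq
    rcases Int.even_or_odd' Y with ⟨Y, rfl | rfl⟩ <;> ring_nf at heq <;> omega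
  · ring_nf at heq; omega
  · obtain ⟨k, hk⟩ := hsq X
    obtain ⟨l, hl⟩ := hsq Z
    obtain ⟨m, hm⟩ := hsq Y
    rw [hk, hl, hm] at heq
    ring_nf at heq
    omega

/-- The admissible t are the representatives of the classes of n and na. They differ because a has
non-trivial class, and `hneg` says that any two admissible t differ by the class of 1 or a. -/
theorem ncard_eq_two_of_isFourPowMulOneMod {U : ℚ → Prop} {n a : ℤ} (hn : n ≠ 0) (ha0 : a ≠ 0)
    (ha : ¬ IsFourPowMulOneMod a)
    (hpos : ∀ t : ℤ, (t = 1 ∨ t = -1 ∨ t = 2 ∨ t = -2) →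
      (IsFourPowMulOneMod (t * n) ∨ IsFourPowMulOneMod (t * (n * a))) → U t)
    (hneg : ∀ t t' : ℤ, (t = 1 ∨ t = -1 ∨ t = 2 ∨ t = -2) → (t' = 1 ∨ t' = -1 ∨ t' = 2 ∨ t' = -2) →
      U t → U t' → IsFourPowMulOneMod (t * t') ∨ IsFourPowMulOneMod (t * t' * a)) :
    {t : ℚ | t ∈ ({1, -1, 2, -2} : Set ℚ) ∧ U t}.ncard = 2 := by
  have hne {t : ℤ} (ht : t = 1 ∨ t = -1 ∨ t = 2 ∨ t = -2) : t ≠ 0 := by omega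
  obtain ⟨t₁, ht₁, h1⟩ := exists_isFourPowMulOneMod_mul hn
  obtain ⟨t₂, ht₂, h2⟩ := exists_isFourPowMulOneMod_mul (mul_ne_zero (hne ht₁) ha0)
  have hself : IsFourPowMulOneMod (t₁ * t₁) := by
    have := (isFourPowMulOneMod_sq_mul_iff ht₁ one_ne_zero).mpr ⟨0, 0, by simp⟩
    rwa [mul_one] at this
  have h12 : t₁ ≠ t₂ := by
    rintro rfl
    rw [← mul_assoc, hself.mul_iff ha0] at h2
    exact ha h2
  have hU1 : U t₁ := hpos t₁ ht₁ (.inl h1)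
  have hU2 : U t₂ := by
    refine hpos t₂ ht₂ (.inr ?_)
    have h3 := (h1.mul_iff (y := t₂ * (t₁ * a)) (mul_ne_zero (hne ht₂) (mul_ne_zero (hne ht₁) ha0))).mpr h2
    rw [show t₁ * n * (t₂ * (t₁ * a)) = t₁ * t₁ * (t₂ * (n * a)) by ring] at h3
    exact (hself.mul_iff (mul_ne_zero (hne ht₂) (mul_ne_zero hn ha0))).mp h3
  rw [Set.ncard_eq_two]
  refine ⟨t₁, t₂, by exact_mod_cast h12, ?_⟩
  have hmem (t : ℚ) : t ∈ ({1, -1, 2, -2} : Set ℚ) ↔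
      ∃ s : ℤ, (s = 1 ∨ s = -1 ∨ s = 2 ∨ s = -2) ∧ t = s := by
    constructor
    · rintro (rfl | rfl | rfl | rfl)
      exacts [⟨1, by simp⟩, ⟨-1, by simp⟩, ⟨2, by simp⟩, ⟨-2, by simp⟩]
    · rintro ⟨s, rfl | rfl | rfl | rfl, rfl⟩ <;> simp
  ext t
  change (t ∈ ({1, -1, 2, -2} : Set ℚ) ∧ U t) ↔ (t = t₁ ∨ t = t₂)
  rw [hmem]
  constructor
  · rintro ⟨⟨s, hs, rfl⟩, hU⟩
    rcases hneg s t₁ hs ht₁ hU hU1 with h | h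
    · exact .inl (by exact_mod_cast eq_of_isFourPowMulOneMod_mul (hne ht₁) hs ht₁ h hself)
    · rw [mul_assoc] at h
      exact .inr (by exact_mod_cast eq_of_isFourPowMulOneMod_mul (mul_ne_zero (hne ht₁) ha0) hs ht₂ h h2)
  · rintro (rfl | rfl)
    exacts [⟨⟨t₁, ht₁, rfl⟩, hU1⟩, ⟨⟨t₂, ht₂, rfl⟩, hU2⟩]

end Arithmetic

end RedeiField

namespace RedeiField

/-! ### Translating conditions on Δ(c) into congruences on c. -/

section Discriminant

theorem mod_four_eq_one_of_not_two_dvd {c : ℤ} (hc : Squarefree c) (hc1 : c ≠ 1) (h : ¬ 2 ∣ Δ c) :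
    c % 4 = 1 := by
  by_contra h4
  rw [Δ_of_mod_four_ne_one hc hc1 h4] at h
  omega

theorem mod_four_ne_one_of_even {c : ℤ} (hc : Squarefree c) (hc1 : c ≠ 1) (h : Even (Δ c)) :
    c % 4 ≠ 1 := by
  intro h4
  rw [Δ_of_mod_four_eq_one hc hc1 h4, Int.even_iff] at h
  omega

theorem dvd_Δ_iff {c : ℤ} (hc : Squarefree c) (hc1 : c ≠ 1) {p : ℕ} (hp : p.Prime) (hp2 : p ≠ 2) :
    (p : ℤ) ∣ Δ c ↔ (p : ℤ) ∣ c := by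
  by_cases h : c % 4 = 1
  · rw [Δ_of_mod_four_eq_one hc hc1 h]
  · rw [Δ_of_mod_four_ne_one hc hc1 h]
    have hpZ := Nat.prime_iff_prime_int.mp hp
    rw [hpZ.dvd_mul]
    refine or_iff_right fun h4 => hp2 ?_
    have h2 : (p : ℤ) ∣ 2 := hpZ.dvd_of_dvd_pow (n := 2) (by norm_num; exact h4)
    exact (Nat.prime_dvd_prime_iff_eq hp Nat.prime_two).mp (by exact_mod_cast h2)

theorem mod_eight_of_Δ {c : ℤ} (hc : Squarefree c) (hc1 : c ≠ 1) {r : ℤ} (hr : r % 2 = 1)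
    (h : Δ c ≡ r [ZMOD 8]) : c % 8 = r % 8 := by
  by_cases h4 : c % 4 = 1
  · rw [Δ_of_mod_four_eq_one hc hc1 h4] at h
    exact h
  · rw [Δ_of_mod_four_ne_one hc hc1 h4, Int.ModEq] at h
    omega

end Discriminant

/-! ### Existence of unramified twists over ℚ, and comparison of two twists. -/

section Cases

theorem map_eq_of_map_div_eq {L : Type*} [Field L] [CharZero L] {σ : L →+* L} {R : L} {d : ℚ}
    (hd : d ≠ 0) (h : σ (R / d) = R / d) : σ R = R := by
  have hd' : (d : L) ≠ 0 := by exact_mod_cast hd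
  rw [map_div₀, map_ratCast] at h
  field_simp at h
  exact h

theorem div_sq_eq_of_eq_mul {L : Type*} [Field L] [CharZero L] {A R : L} {t x y q d : ℚ}
    {r X Y : ℤ} (hX : x = q ^ 2 * r * X) (hY : y = q ^ 2 * r * Y) (hR : R ^ 2 = t * (x + y * A)) :
    (R / d) ^ 2 = t * q ^ 2 * r / d ^ 2 * (X + Y * A) := by
  rw [div_pow, hR, hX, hY]
  push_cast
  ring

variable {a b : ℤ} {α β : ℂ} {x y z t t' : ℚ} {X Y Z r : ℤ} {q : ℚ} {p : ℕ}

theorem exists_unramifiedOver_twist_of_odd (hp : p.Prime) (hp2 : p ≠ 2) (hα : α ^ 2 = a)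
    (hβ : β ^ 2 = b) (heq : x ^ 2 - a * y ^ 2 = b * z ^ 2) (hxy : (x : ℂ) + y * α ≠ 0)
    (hq : q ≠ 0) (hr : r = 1 ∨ r = p) (hX : x = q ^ 2 * r * X) (hY : y = q ^ 2 * r * Y)
    (heqZ : X ^ 2 - a * Y ^ 2 = b * Z ^ 2)
    (hprim : ¬ ((p : ℤ) ∣ X ∧ (p : ℤ) ∣ Y ∧ (p : ℤ) ∣ Z))
    (ha : ¬ (p : ℤ) ∣ a) (hb : ¬ (p : ℤ) ∣ b) :
    UnramifiedOver ℚ (twist a b α x y r) p := by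
  have hr0 : (r : ℚ) ≠ 0 := by
    rcases hr with rfl | rfl
    · simp
    · exact_mod_cast hp.ne_zero
  have hβ0 : ((r : ℚ) : ℂ) * (x + y * α) ≠ 0 := mul_ne_zero (by exact_mod_cast hr0) hxy
  obtain ⟨_, _⟩ := numberField_and_isGalois_twist hα heq hβ0
  obtain ⟨A, B, R, hA, hB, hR, hR0, -, -, hgen⟩ := exists_twist_generators hα hβ hβ0
  refine unramifiedOver_of_generators hp hgen fun P hP hpP σ hσ _ => ?_
  have hσA := hσ.map_eq_of_sq_eq_intCast hp hp2 hpP hA ha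
  have hσB := hσ.map_eq_of_sq_eq_intCast hp hp2 hpP hB hb
  -- Twisting by r itself cancels the scalar: R² = (qr)²(X + YA).
  have hd : q * r ≠ 0 := mul_ne_zero hq hr0
  refine ⟨hσA, hσB, map_eq_of_map_div_eq hd ?_⟩
  have hd' : ((q * r : ℚ) : twist a b α x y r) ≠ 0 := by exact_mod_cast hd
  refine hσ.map_eq_of_not_dvd hp hp2 hpP hA hB hσA hσB (div_ne_zero hR0 hd') ?_ heqZ ha hb hprim
  have hq' : (q : twist a b α x y r) ≠ 0 := by exact_mod_cast hq
  have hr' : (r : twist a b α x y r) ≠ 0 := by exact_mod_cast hr0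
  rw [div_sq_eq_of_eq_mul hX hY hR]
  push_cast
  field_simp

theorem exists_unramifiedOver_twist_of_two (hα : α ^ 2 = a)
    (hβ : β ^ 2 = b) (heq : x ^ 2 - a * y ^ 2 = b * z ^ 2) (hxy : (x : ℂ) + y * α ≠ 0)
    (hb0 : Squarefree b) (hb1 : b ≠ 1)
    (hq : q ≠ 0) (hr : r = 1 ∨ r = 2) (hX : x = q ^ 2 * r * X) (hY : y = q ^ 2 * r * Y)
    (heqZ : X ^ 2 - a * Y ^ 2 = b * Z ^ 2)
    (hprim : ¬ (2 ∣ X ∧ 2 ∣ Y ∧ 2 ∣ Z)) (ha : a % 4 = 1) (hb : b % 4 = 1) :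
    ∃ t : ℤ, (t = 1 ∨ t = -1 ∨ t = 2 ∨ t = -2) ∧ UnramifiedOver ℚ (twist a b α x y t) 2 := by
  obtain ⟨hXodd, hYZ⟩ := mod_four_cases ha hb heqZ hprim
  have main (t : ℤ) (ht : t = 1 ∨ t = -1 ∨ t = 2 ∨ t = -2) (d : ℚ) (hd : d ≠ 0)
      (h : ∀ (P : Ideal (𝓞 (twist a b α x y t))) (σ : twist a b α x y t →+* twist a b α x y t)
        (A B R : twist a b α x y t), NumberField (twist a b α x y t) → P.IsPrime →
        (2 : 𝓞 (twist a b α x y t)) ∈ P → IsInert P σ → A ^ 2 = a → B ^ 2 = b → σ A = A → σ B = B →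
        R ≠ 0 → R ^ 2 = t * q ^ 2 * r / d ^ 2 * (X + Y * A) → σ R = R) :
      UnramifiedOver ℚ (twist a b α x y t) 2 := by
    have ht0 : (t : ℚ) ≠ 0 := by exact_mod_cast (by omega : t ≠ 0)
    have hβ0 : ((t : ℚ) : ℂ) * (x + y * α) ≠ 0 := mul_ne_zero (by exact_mod_cast ht0) hxy
    obtain ⟨_, _⟩ := numberField_and_isGalois_twist hα heq hβ0
    obtain ⟨A, B, R, hA, hB, hR, hR0, -, -, hgen⟩ := exists_twist_generators hα hβ hβ0
    refine unramifiedOver_of_generators Nat.prime_two hgen fun P hP hpP σ hσ _ => ?_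
    have h2 : (2 : 𝓞 (twist a b α x y t)) ∈ P := by exact_mod_cast hpP
    have hσA := hσ.map_eq_of_sq_eq_intCast_two h2 hA ha
    have hσB := hσ.map_eq_of_sq_eq_intCast_two h2 hB hb
    have hd' : (d : twist a b α x y t) ≠ 0 := by exact_mod_cast hd
    refine ⟨hσA, hσB, map_eq_of_map_div_eq hd (h P σ A B (R / d) inferInstance hP h2 hσ hA hB hσA hσB
      (div_ne_zero hR0 hd') ?_)⟩
    rw [div_sq_eq_of_eq_mul hX hY hR]
    push_cast
    ring
  have hr0 : (r : ℚ) ≠ 0 := by exact_mod_cast (by omega : r ≠ 0)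
  -- X is odd and exactly one of Y, Z is even. For Y even, X + YA is ±1 times a square modulo 4, so
  -- the twist is ±r; for Z even, the conic identity brings in an extra factor 2. The sign δ gives X
  -- - Y, or X - Z, the residue 1 mod 4.
  rcases hYZ with ⟨hY0, -⟩ | ⟨-, hZ0⟩
  · obtain ⟨δ, hδ, hδX⟩ : ∃ δ : ℤ, (δ = 1 ∨ δ = -1) ∧ (δ * (X - Y)) % 4 = 1 := by
      have h : (X - Y) % 4 = 1 ∨ (X - Y) % 4 = 3 := by omega
      rcases h with h | h
      · exact ⟨1, .inl rfl, by rwa [one_mul]⟩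
      · exact ⟨-1, .inr rfl, by omega⟩
    have ht : δ * r = 1 ∨ δ * r = -1 ∨ δ * r = 2 ∨ δ * r = -2 := by
      rcases hδ with rfl | rfl <;> rcases hr with rfl | rfl <;> simp
    refine ⟨δ * r, ht, main _ ht (q * r) (mul_ne_zero hq hr0) ?_⟩
    intro P σ A B R _ hP h2 hσ hA hB hσA hσB hR0 hR
    refine hσ.map_eq_of_sq_eq_add_mul h2 hA ha hσA (u := δ * X) (v := δ * Y) ?_ ?_ ?_
    · have hq' : (q : twist a b α x y (δ * r : ℤ)) ≠ 0 := by exact_mod_cast hq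
      have hr' : (r : twist a b α x y (δ * r : ℤ)) ≠ 0 := by exact_mod_cast hr0
      rw [hR]
      push_cast
      field_simp
    · rcases hδ with rfl | rfl <;> omega
    · rwa [← mul_sub]
  · obtain ⟨δ, hδ, hδX⟩ : ∃ δ : ℤ, (δ = 1 ∨ δ = -1) ∧ (δ * (X - Z)) % 4 = 1 := by
      have h : (X - Z) % 4 = 1 ∨ (X - Z) % 4 = 3 := by omega
      rcases h with h | h
      · exact ⟨1, .inl rfl, by rwa [one_mul]⟩
      · exact ⟨-1, .inr rfl, by omega⟩
    obtain ⟨t, ht, htr⟩ : ∃ t : ℤ, (t = 1 ∨ t = -1 ∨ t = 2 ∨ t = -2) ∧ t * r = 2 * δ := by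
      rcases hr with rfl | rfl
      · exact ⟨2 * δ, by omega, by ring⟩
      · exact ⟨δ, by omega, by ring⟩
    refine ⟨t, ht, main t ht q hq ?_⟩
    intro P σ A B R _ hP h2 hσ hA hB hσA hσB hR0 hR
    have hq' : (q : twist a b α x y t) ≠ 0 := by exact_mod_cast hq
    refine hσ.map_eq_of_swap h2 hA hB hb hσA hσB hR0 hδ ?_ heqZ ?_ hZ0 hδX
    · rw [hR]
      have : (t : twist a b α x y t) * r = 2 * δ := by exact_mod_cast htr
      rw [← this]
      field_simp
    · have hX0 : (X : ℚ) ≠ 0 := by exact_mod_cast (by omega : X ≠ 0)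
      have := add_mul_sqrt_ne_zero hb0 hb1 hB (u := X) (v := Z) (.inl hX0)
      exact_mod_cast this

theorem map_eq_of_inert_of_unramifiedOver {K : Type*} [Field K] [NumberField K] (hp : p.Prime)
    (hα : α ^ 2 = a) (heq : x ^ 2 - a * y ^ 2 = b * z ^ 2)
    (hβ0 : (t : ℂ) * (x + y * α) ≠ 0) {M : IntermediateField ℚ ℂ} [NumberField M]
    (hM : twist a b α x y t ≤ M)
    [Algebra K (twist a b α x y t)] [Algebra K M]
    (hK : ∀ k, (algebraMap K M k : ℂ) = algebraMap K (twist a b α x y t) k)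
    (hunr : UnramifiedOver K (twist a b α x y t) p)
    {P : Ideal (𝓞 M)} [P.IsPrime] (hpP : (p : 𝓞 M) ∈ P) {σ : M ≃ₐ[ℚ] M}
    (hσ : IsInert P (σ : M →+* M)) (hσK : ∀ k : K, σ (algebraMap K M k) = algebraMap K M k)
    {w : ℂ} (hw : w ∈ twist a b α x y t) : σ ⟨w, hM hw⟩ = ⟨w, hM hw⟩ := by
  obtain ⟨_, _⟩ := numberField_and_isGalois_twist hα heq hβ0
  let i : twist a b α x y t →ₐ[K] M :=
    { (IntermediateField.inclusion hM).toRingHom with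
      commutes' := fun k => Subtype.ext (hK k).symm }
  exact hunr.map_eq_of_inert_rat hp i hpP hσ hσK ⟨w, hw⟩

theorem exists_sqrt_mul_mem_sup (hxy : (x : ℂ) + y * α ≠ 0) (ht : t ≠ 0)
    (ht' : t' ≠ 0) : ∃ ρ ρ' : ℂ, ρ ∈ twist a b α x y t ∧ ρ' ∈ twist a b α x y t' ∧
      (ρ * ρ' / (x + y * α)) ^ 2 = t * t' ∧ ρ * ρ' / (x + y * α) ≠ 0 := by
  obtain ⟨ρ, hρ⟩ := exists_complex_sqrt ((t : ℂ) * (x + y * α))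
  obtain ⟨ρ', hρ'⟩ := exists_complex_sqrt ((t' : ℂ) * (x + y * α))
  have h : (ρ * ρ' / (x + y * α)) ^ 2 = t * t' := by
    rw [div_pow, mul_pow, hρ, hρ']; field_simp
  refine ⟨ρ, ρ', mem_twist hρ, mem_twist hρ', h, fun h0 => ?_⟩
  rw [h0] at h
  have h2 : (t : ℂ) * t' ≠ 0 := by exact_mod_cast mul_ne_zero ht ht'
  exact h2 (by rw [← h]; simp)

/-- The square root of `tt'` in the compositum of two unramified twists is fixed by all inertia
elements over `K` that fix `√a`. -/
theorem exists_sqrt_fixed_by_inert {K : Type*} [Field K] [NumberField K] (hp : p.Prime)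
    (hα : α ^ 2 = a) (heq : x ^ 2 - a * y ^ 2 = b * z ^ 2) (hxy : (x : ℂ) + y * α ≠ 0)
    (ht : t ≠ 0) (ht' : t' ≠ 0)
    [Algebra K (twist a b α x y t)] [Algebra K (twist a b α x y t')]
    [Algebra K ↥(twist a b α x y t ⊔ twist a b α x y t')]
    (hK : ∀ k, (algebraMap K ↥(twist a b α x y t ⊔ twist a b α x y t') k : ℂ) =
      algebraMap K (twist a b α x y t) k)
    (hK' : ∀ k, (algebraMap K ↥(twist a b α x y t ⊔ twist a b α x y t') k : ℂ) =
      algebraMap K (twist a b α x y t') k)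
    (hunr : UnramifiedOver K (twist a b α x y t) p)
    (hunr' : UnramifiedOver K (twist a b α x y t') p) :
    ∃ S : ↥(twist a b α x y t ⊔ twist a b α x y t'), S ^ 2 = ((t * t' : ℚ) :
      ↥(twist a b α x y t ⊔ twist a b α x y t')) ∧ S ≠ 0 ∧
      ∀ P : Ideal (𝓞 ↥(twist a b α x y t ⊔ twist a b α x y t')), P.IsPrime → (p : 𝓞 _) ∈ P →
      ∀ σ : ↥(twist a b α x y t ⊔ twist a b α x y t') ≃ₐ[ℚ] ↥(twist a b α x y t ⊔ twist a b α x y t'),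
      IsInert P (σ : _ →+* _) → (∀ k : K, σ (algebraMap K _ k) = algebraMap K _ k) → σ S = S := by
  have hβ0 : (t : ℂ) * (x + y * α) ≠ 0 := mul_ne_zero (by exact_mod_cast ht) hxy
  have hβ0' : (t' : ℂ) * (x + y * α) ≠ 0 := mul_ne_zero (by exact_mod_cast ht') hxy
  obtain ⟨_, _⟩ := numberField_and_isGalois_twist_sup hα heq hβ0 hβ0'
  obtain ⟨ρ, ρ', hρ, hρ', h1, h2⟩ := exists_sqrt_mul_mem_sup (a := a) (b := b) hxy ht ht'
  have hle : twist a b α x y t ≤ twist a b α x y t ⊔ twist a b α x y t' := le_sup_left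
  have hle' : twist a b α x y t' ≤ twist a b α x y t ⊔ twist a b α x y t' := le_sup_right
  have hαm : α ∈ twist a b α x y t := mem_twist_left hα
  let S : ↥(twist a b α x y t ⊔ twist a b α x y t') :=
    ⟨ρ, hle hρ⟩ * ⟨ρ', hle' hρ'⟩ / ((x : ↥(twist a b α x y t ⊔ twist a b α x y t')) + y * ⟨α, hle hαm⟩)
  have hS : (S : ℂ) = ρ * ρ' / (x + y * α) := by simp [S]
  refine ⟨S, Subtype.ext ?_, fun h => h2 (by rw [← hS, h]; rfl), fun P hP hpP σ hσ hσK => ?_⟩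
  · push_cast
    rw [hS, h1]
  · have e1 := map_eq_of_inert_of_unramifiedOver hp hα heq hβ0 hle hK hunr hpP hσ hσK hρ
    have e2 := map_eq_of_inert_of_unramifiedOver hp hα heq hβ0' hle' hK' hunr' hpP hσ hσK hρ'
    have e3 := map_eq_of_inert_of_unramifiedOver hp hα heq hβ0 hle hK hunr hpP hσ hσK hαm
    simp only [S, map_div₀, map_mul, map_add, map_ratCast, e1, e2, e3]

end Cases

end RedeiField

namespace RedeiField

variable {a b : ℤ} {α β : ℂ} {x y z t t' : ℚ} {X Y Z r : ℤ} {q : ℚ} {p : ℕ}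

/-! ### Uniqueness of the unramified twist over ℚ. -/

section Rational

/-- Two different unramified twists would put √p in an extension whose inertia at p fixes it,
although p ramifies in ℚ(√p). -/
theorem eq_of_unramifiedOver_twist_of_odd (hp : p.Prime) (hα : α ^ 2 = a)
    (heq : x ^ 2 - a * y ^ 2 = b * z ^ 2) (hxy : (x : ℂ) + y * α ≠ 0)
    (ht : t = 1 ∨ t = p) (ht' : t' = 1 ∨ t' = p) (h : UnramifiedOver ℚ (twist a b α x y t) p)
    (h' : UnramifiedOver ℚ (twist a b α x y t') p) : t = t' := by
  by_contra hne
  have hp0 : (p : ℚ) ≠ 0 := by exact_mod_cast hp.ne_zero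
  have htt : t * t' = p := by
    rcases ht with rfl | rfl <;> rcases ht' with rfl | rfl <;> simp_all
  have ht0 : t ≠ 0 := by rintro rfl; simp at htt; exact hp0 htt.symm
  have ht0' : t' ≠ 0 := by rintro rfl; simp at htt; exact hp0 htt.symm
  obtain ⟨_, _⟩ := numberField_and_isGalois_twist_sup hα heq
    (mul_ne_zero (by exact_mod_cast ht0) hxy) (mul_ne_zero (by exact_mod_cast ht0') hxy)
  obtain ⟨S, hS, hS0, hfix⟩ := exists_sqrt_fixed_by_inert hp hα heq hxy ht0 ht0' (by simp) (by simp)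
    h h'
  obtain ⟨P, hP, hpP⟩ := exists_prime_over ↥(twist a b α x y t ⊔ twist a b α x y t') hp
  rw [htt] at hS
  obtain ⟨σ, hσ, hσS⟩ := exists_inert_neg_of_sq_eq_prime hp hpP (s := S) (by simpa using hS)
  rw [hfix P hP hpP σ hσ (by simp)] at hσS
  exact hS0 (self_eq_neg.mp hσS)

theorem eq_of_unramifiedOver_twist_of_two (hα : α ^ 2 = a)
    (heq : x ^ 2 - a * y ^ 2 = b * z ^ 2) (hxy : (x : ℂ) + y * α ≠ 0) {t t' : ℤ}
    (ht : t = 1 ∨ t = -1 ∨ t = 2 ∨ t = -2) (ht' : t' = 1 ∨ t' = -1 ∨ t' = 2 ∨ t' = -2)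
    (h : UnramifiedOver ℚ (twist a b α x y t) 2)
    (h' : UnramifiedOver ℚ (twist a b α x y t') 2) : t = t' := by
  have ht0 : t ≠ 0 := by omega
  have ht0' : t' ≠ 0 := by omega
  have ht0q : (t : ℚ) ≠ 0 := by exact_mod_cast ht0
  have ht0q' : (t' : ℚ) ≠ 0 := by exact_mod_cast ht0'
  obtain ⟨_, _⟩ := numberField_and_isGalois_twist_sup hα heq
    (mul_ne_zero (Rat.cast_ne_zero.mpr ht0q) hxy) (mul_ne_zero (Rat.cast_ne_zero.mpr ht0q') hxy)
  obtain ⟨S, hS, hS0, hfix⟩ := exists_sqrt_fixed_by_inert Nat.prime_two hα heq hxy ht0q ht0q'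
    (by simp) (by simp) h h'
  obtain ⟨P, hP, hpP⟩ :=
    exists_prime_over ↥(twist a b α x y t ⊔ twist a b α x y t') Nat.prime_two
  refine eq_of_isFourPowMulOneMod_mul ht0' ht ht' ?_ ?_
  · by_contra hc
    obtain ⟨σ, hσ, hσS⟩ := exists_inert_neg_of_not_isFourPowMulOneMod (P := P)
      (by exact_mod_cast hpP) (s := S) (by rw [hS]; push_cast; rfl) (mul_ne_zero ht0 ht0') hc
    rw [hfix P hP hpP σ hσ (by simp)] at hσS
    exact hS0 (self_eq_neg.mp hσS)
  · have := (isFourPowMulOneMod_sq_mul_iff ht' one_ne_zero).mpr ⟨0, 0, rfl⟩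
    rwa [mul_one] at this

end Rational

/-! ### Ramification over K = ℚ(√(ab)). -/

section QuadraticBase

/-- An intermediate field contained in another one, made into its base field. -/
noncomputable abbrev algebraOfLe {F G : IntermediateField ℚ ℂ} (h : F ≤ G) : Algebra F G :=
  (IntermediateField.inclusion h).toRingHom.toAlgebra

theorem coe_algebraMap_algebraOfLe {F G : IntermediateField ℚ ℂ} (h : F ≤ G) (k : F) :
    ((algebraOfLe h).algebraMap k : ℂ) = k := rfl

/-- Passes to the same field viewed inside ℂ over ℚ, where the Galois property over ℚ is available.
-/
theorem unramifiedOver_twistOverK_iff :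
    UnramifiedOver (sqrtField (a * b)) (twistOverK a b α x y t) p ↔
      @UnramifiedOver (sqrtField (a * b)) (twist a b α x y t) _ _
        (algebraOfLe (sqrtField_mul_le_extField a b α (t * x) (t * y))) p := Iff.rfl

theorem map_mul_eq_of_fixes_sqrtField {G : IntermediateField ℚ ℂ} (h : sqrtField (a * b) ≤ G)
    {σ : G →+* G} {A B : G} (hA : A ^ 2 = a) (hB : B ^ 2 = b)
    (hσ : ∀ k : sqrtField (a * b), σ (IntermediateField.inclusion h k) =
      IntermediateField.inclusion h k) : σ (A * B) = A * B := by
  have hAB : ((A * B : G) : ℂ) ^ 2 = (a * b : ℤ) := by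
    have : (A * B) ^ 2 = ((a * b : ℤ) : G) := by rw [mul_pow, hA, hB]; push_cast; rfl
    have := congrArg (Subtype.val : G → ℂ) this
    simpa using this
  exact hσ ⟨_, mem_sqrtField hAB⟩

theorem fixes_sqrtField_of_map_eq {G : IntermediateField ℚ ℂ} (h : sqrtField (a * b) ≤ G)
    {σ : G →+* G} {A B : G} (hA : A ^ 2 = a) (hB : B ^ 2 = b) (hσA : σ A = A) (hσB : σ B = B)
    (k : sqrtField (a * b)) : σ (IntermediateField.inclusion h k) =
      IntermediateField.inclusion h k := by
  have hAB : ((A * B : G) : ℂ) ^ 2 = (a * b : ℤ) := by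
    have : (A * B) ^ 2 = ((a * b : ℤ) : G) := by rw [mul_pow, hA, hB]; push_cast; rfl
    have := congrArg (Subtype.val : G → ℂ) this
    simpa using this
  exact map_eq_of_mem_sqrtField h σ hAB (A * B).2 (by
    change σ (A * B) = A * B
    rw [map_mul, hσA, hσB]) k.2

theorem ne_zero_of_sq_eq_intCast {L : Type*} [Field L] [CharZero L] {s : L} {n : ℤ} (hn : n ≠ 0)
    (h : s ^ 2 = n) : s ≠ 0 := by
  rintro rfl
  exact hn (by exact_mod_cast (by simpa using h.symm : (n : L) = 0))

theorem unramifiedOver_extFieldOverK_of_dvd (hp : p.Prime) (hp2 : p ≠ 2) (hα : α ^ 2 = a)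
    (hβ : β ^ 2 = b) (heq : x ^ 2 - a * y ^ 2 = b * z ^ 2) (hxy : (x : ℂ) + y * α ≠ 0)
    (hq : q ≠ 0) (hr : r = 1 ∨ r = p) (hX : x = q ^ 2 * r * X) (hY : y = q ^ 2 * r * Y)
    (heqZ : X ^ 2 - a * Y ^ 2 = b * Z ^ 2)
    (hprim : ¬ ((p : ℤ) ∣ X ∧ (p : ℤ) ∣ Y ∧ (p : ℤ) ∣ Z))
    (ha0 : Squarefree a) (ha : (p : ℤ) ∣ a) (hb : ¬ (p : ℤ) ∣ b) :
    UnramifiedOver (sqrtField (a * b)) (extFieldOverK a b α x y) p := by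
  have h1 : extFieldOverK a b α x y = twistOverK a b α x y 1 := by simp [twistOverK]
  rw [h1, unramifiedOver_twistOverK_iff]
  let _ : Algebra (sqrtField (a * b)) (twist a b α x y 1) :=
    algebraOfLe (sqrtField_mul_le_extField a b α (1 * x) (1 * y))
  have hβ0 : ((1 : ℚ) : ℂ) * (x + y * α) ≠ 0 := by simpa using hxy
  obtain ⟨_, _⟩ := numberField_and_isGalois_twist hα heq hβ0
  obtain ⟨A, B, R, hA, hB, hR, hR0, -, -, hgen⟩ := exists_twist_generators hα hβ hβ0
  refine unramifiedOver_of_generators hp hgen fun P hP hpP σ hσ hσK => ?_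
  have hb0 : b ≠ 0 := by rintro rfl; simp at hb
  have hσB := hσ.map_eq_of_sq_eq_intCast hp hp2 hpP hB hb
  -- Although p ramifies in ℚ(√a), σ fixes A: it fixes AB ∈ K, and it fixes B since p ∤ b.
  have hσA := map_sqrt_eq_of_map_mul_eq (ne_zero_of_sq_eq_intCast hb0 hB) hσB
    (map_mul_eq_of_fixes_sqrtField (sqrtField_mul_le_extField a b α (1 * x) (1 * y)) hA hB hσK)
  refine ⟨hσA, hσB, map_eq_of_map_div_eq hq ?_⟩
  have hq' : (q : twist a b α x y 1) ≠ 0 := by exact_mod_cast hq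
  refine hσ.map_eq_of_dvd hp hp2 hpP hA hσA hr ?_ heqZ ha0 ha hb hprim
  rw [div_sq_eq_of_eq_mul hX hY hR]
  push_cast
  field_simp

theorem not_unramifiedOver_twistOverK (hα : α ^ 2 = a) (hβ : β ^ 2 = b)
    (heq : x ^ 2 - a * y ^ 2 = b * z ^ 2) (hxy : (x : ℂ) + y * α ≠ 0) (hy : y ≠ 0)
    (ha : a % 4 = 3) (hb : b % 8 = 5) (ht : t ≠ 0) :
    ¬ UnramifiedOver (sqrtField (a * b)) (twistOverK a b α x y t) 2 := by
  rw [unramifiedOver_twistOverK_iff]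
  let _ : Algebra (sqrtField (a * b)) (twist a b α x y t) :=
    algebraOfLe (sqrtField_mul_le_extField a b α (t * x) (t * y))
  have hβ0 : (t : ℂ) * (x + y * α) ≠ 0 := mul_ne_zero (by exact_mod_cast ht) hxy
  obtain ⟨_, _⟩ := numberField_and_isGalois_twist hα heq hβ0
  obtain ⟨A, B, R, hA, hB, hR, hR0, -⟩ := exists_twist_generators hα hβ hβ0
  exact not_unramifiedOver_two_of_inert hA hB hR0 hR heq hy ha hb fun σ hσA hσB =>
    fixes_sqrtField_of_map_eq (sqrtField_mul_le_extField a b α (t * x) (t * y)) hA hB hσA hσB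

theorem isFourPowMulOneMod_of_unramifiedOver_twistOverK (hα : α ^ 2 = a) (hβ : β ^ 2 = b)
    (heq : x ^ 2 - a * y ^ 2 = b * z ^ 2) (hxy : (x : ℂ) + y * α ≠ 0) (ha0 : a ≠ 0)
    (hb : b % 4 = 1) {t t' : ℤ} (ht : t ≠ 0) (ht' : t' ≠ 0)
    (h : UnramifiedOver (sqrtField (a * b)) (twistOverK a b α x y t) 2)
    (h' : UnramifiedOver (sqrtField (a * b)) (twistOverK a b α x y t') 2) :
    IsFourPowMulOneMod (t * t') ∨ IsFourPowMulOneMod (t * t' * a) := by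
  rw [unramifiedOver_twistOverK_iff] at h h'
  have htq : (t : ℚ) ≠ 0 := by exact_mod_cast ht
  have htq' : (t' : ℚ) ≠ 0 := by exact_mod_cast ht'
  have hle : sqrtField (a * b) ≤ twist a b α x y t := sqrtField_mul_le_extField ..
  have hle' : sqrtField (a * b) ≤ twist a b α x y t' := sqrtField_mul_le_extField ..
  have hM : sqrtField (a * b) ≤ twist a b α x y t ⊔ twist a b α x y t' := hle.trans le_sup_left
  let _ := algebraOfLe hle
  let _ := algebraOfLe hle'
  let _ := algebraOfLe hM
  obtain ⟨_, _⟩ := numberField_and_isGalois_twist_sup hα heq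
    (mul_ne_zero (Rat.cast_ne_zero.mpr htq) hxy) (mul_ne_zero (Rat.cast_ne_zero.mpr htq') hxy)
  obtain ⟨S, hS, hS0, hfix⟩ := exists_sqrt_fixed_by_inert (K := sqrtField (a * b)) Nat.prime_two
    hα heq hxy htq htq'
    (fun k => (coe_algebraMap_algebraOfLe hM k).trans (coe_algebraMap_algebraOfLe hle k).symm)
    (fun k => (coe_algebraMap_algebraOfLe hM k).trans (coe_algebraMap_algebraOfLe hle' k).symm) h h'
  obtain ⟨P, hP, hpP⟩ :=
    exists_prime_over ↥(twist a b α x y t ⊔ twist a b α x y t') Nat.prime_two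
  have h2 : (2 : 𝓞 ↥(twist a b α x y t ⊔ twist a b α x y t')) ∈ P := by exact_mod_cast hpP
  have hmem : twist a b α x y t ≤ twist a b α x y t ⊔ twist a b α x y t' := le_sup_left
  obtain ⟨A, hA⟩ : ∃ A : ↥(twist a b α x y t ⊔ twist a b α x y t'), A ^ 2 = a :=
    ⟨⟨α, hmem (mem_twist_left hα)⟩, Subtype.ext (by simpa using hα)⟩
  obtain ⟨B, hB⟩ : ∃ B : ↥(twist a b α x y t ⊔ twist a b α x y t'), B ^ 2 = b :=
    ⟨⟨β, hmem (mem_twist_right hβ)⟩, Subtype.ext (by simpa using hβ)⟩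
  refine isFourPowMulOneMod_or_of_inert h2 hA (S := S) (by rw [hS]; push_cast; rfl) ha0
    (mul_ne_zero ht ht') fun σ hσ hσA => hfix P hP hpP σ hσ fun k => ?_
  exact fixes_sqrtField_of_map_eq hM (σ := (σ : _ →+* _)) hA hB hσA
    (hσ.map_eq_of_sq_eq_intCast_two h2 hB hb) k

theorem unramifiedOver_twistOverK_of_split (hα : α ^ 2 = a) (hβ : β ^ 2 = b)
    (heq : x ^ 2 - a * y ^ 2 = b * z ^ 2) (hxy : (x : ℂ) + y * α ≠ 0) (ha0 : a ≠ 0)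
    (hb0 : Squarefree b) (hb1 : b ≠ 1) (hb : b % 4 = 1)
    (hq : q ≠ 0) (hr : r ≠ 0) (hX : x = q ^ 2 * r * X) (hY : y = q ^ 2 * r * Y)
    (heqZ : X ^ 2 - a * Y ^ 2 = b * Z ^ 2) (hY0 : Y ≠ 0) {w c : ℤ} {N : ℕ} (hw : w % 2 = 1)
    (hwb : b - w ^ 2 = 4 ^ N * c) (hN : ¬ 4 ^ N ∣ 8 * r * a ^ 2 * Y ^ 2)
    {t : ℤ} (ht : t = 1 ∨ t = -1 ∨ t = 2 ∨ t = -2) {e : ℤ} (he : e = 1 ∨ e = a)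
    (h : IsFourPowMulOneMod (t * (2 * r * (X + Z * w) * e))) :
    UnramifiedOver (sqrtField (a * b)) (twistOverK a b α x y t) 2 := by
  obtain ⟨k, m, hkm⟩ := h
  -- Bounds the 2-adic size of X + Zw: modulo 4^N, (X + Zw)(X - Zw) ≡ X² - bZ² = aY², so 4^N
  -- dividing the class representative would make it divide 8ra²Y². Hence w² approximates b at least
  -- to the order 4^(k+1) needed.
  have hkN : k < N := by
    by_contra! hNk
    refine hN ?_
    have h1 : (4 : ℤ) ^ N ∣ t * (2 * r * (X + Z * w) * e) :=
      (pow_dvd_pow 4 hNk).trans ⟨_, hkm⟩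
    have h2 : (4 : ℤ) ^ N ∣ 4 * r * a * (X + Z * w) := by
      -- Multiplying by s and f replaces t by ±2 and e by a, which treats all choices of t and e at
      -- once.
      obtain ⟨s, hs⟩ : ∃ s, t * s = 2 ∨ t * s = -2 := by
        rcases ht with rfl | rfl | rfl | rfl
        exacts [⟨2, by norm_num⟩, ⟨2, by norm_num⟩, ⟨1, by norm_num⟩, ⟨1, by norm_num⟩]
      obtain ⟨f, hf⟩ : ∃ f, e * f = a := by
        rcases he with rfl | rfl
        exacts [⟨a, one_mul _⟩, ⟨1, mul_one _⟩]
      have h3 := h1.mul_right (s * f)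
      have h4 : t * (2 * r * (X + Z * w) * e) * (s * f) = (t * s) * (2 * r * a * (X + Z * w)) := by
        rw [← hf]; ring
      rw [h4] at h3
      rw [show 4 * r * a * (X + Z * w) = 2 * (2 * r * a * (X + Z * w)) by ring]
      rcases hs with hs | hs <;> rw [hs] at h3
      · exact h3
      · rwa [neg_mul, dvd_neg] at h3
    have h5 : 8 * r * a ^ 2 * Y ^ 2 = 4 * r * a * (X + Z * w) * (2 * (X - Z * w)) -
        4 ^ N * (8 * r * a * c * Z ^ 2) := by
      linear_combination (-8 * r * a) * heqZ - (8 * r * a * Z ^ 2) * hwb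
    rw [h5]
    exact dvd_sub (h2.mul_right _) (dvd_mul_right _ _)
  rw [unramifiedOver_twistOverK_iff]
  let _ : Algebra (sqrtField (a * b)) (twist a b α x y t) :=
    algebraOfLe (sqrtField_mul_le_extField a b α (t * x) (t * y))
  have ht0 : t ≠ 0 := by omega
  have hβ0 : ((t : ℚ) : ℂ) * (x + y * α) ≠ 0 := mul_ne_zero (by exact_mod_cast ht0) hxy
  obtain ⟨_, _⟩ := numberField_and_isGalois_twist hα heq hβ0
  obtain ⟨A, B, R, hA, hB, hR, hR0, -, -, hgen⟩ := exists_twist_generators hα hβ hβ0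
  refine unramifiedOver_of_generators Nat.prime_two hgen fun P hP hpP σ hσ hσK => ?_
  have h2 : (2 : 𝓞 (twist a b α x y t)) ∈ P := by exact_mod_cast hpP
  have hσB := hσ.map_eq_of_sq_eq_intCast_two h2 hB hb
  have hσA := map_sqrt_eq_of_map_mul_eq (ne_zero_of_sq_eq_intCast (by omega : b ≠ 0) hB) hσB
    (map_mul_eq_of_fixes_sqrtField (sqrtField_mul_le_extField a b α (t * x) (t * y)) hA hB hσK)
  refine ⟨hσA, hσB, map_eq_of_map_div_eq hq ?_⟩
  have hq' : (q : twist a b α x y t) ≠ 0 := by exact_mod_cast hq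
  have hXZ : (X : ℚ) ≠ 0 ∨ (Z : ℚ) ≠ 0 := by
    by_contra! hcon
    have h6 : X = 0 := by exact_mod_cast hcon.1
    have h7 : Z = 0 := by exact_mod_cast hcon.2
    subst h6 h7
    have h8 : a * Y ^ 2 = 0 := by linear_combination -heqZ
    exact mul_ne_zero ha0 (pow_ne_zero 2 hY0) h8
  have hXB := add_mul_sqrt_ne_zero hb0 hb1 hB hXZ
  have hXB' := add_mul_sqrt_ne_zero hb0 hb1 hB (u := X) (v := -Z) (hXZ.imp_right neg_ne_zero.mpr)
  push_cast at hXB hXB'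
  rw [neg_mul, ← sub_eq_add_neg] at hXB'
  refine hσ.map_eq_of_split h2 hA hB hb hσA hσB ha0 (div_ne_zero hR0 hq') (t := t * r) ?_ heqZ hXB
    hXB' (c := 4 ^ (N - k - 1) * c) (k := k) (m := m) hw ?_ he ?_
  · rw [div_sq_eq_of_eq_mul hX hY hR]
    push_cast
    field_simp
  · rw [hwb, ← mul_assoc, ← pow_add, show k + 1 + (N - k - 1) = N by omega]
  · rw [← hkm]; ring

theorem ncard_unramifiedOver_twistOverK (hα : α ^ 2 = a) (hβ : β ^ 2 = b)
    (heq : x ^ 2 - a * y ^ 2 = b * z ^ 2) (hxy : (x : ℂ) + y * α ≠ 0)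
    (ha0 : Squarefree a) (ha : a % 4 ≠ 1)
    (hb0 : Squarefree b) (hb1 : b ≠ 1) (hb : b % 8 = 1)
    (hq : q ≠ 0) (hr : r ≠ 0) (hX : x = q ^ 2 * r * X) (hY : y = q ^ 2 * r * Y)
    (heqZ : X ^ 2 - a * Y ^ 2 = b * Z ^ 2) (hY0 : Y ≠ 0) :
    {t : ℚ | t ∈ ({1, -1, 2, -2} : Set ℚ) ∧
      UnramifiedOver (sqrtField (a * b)) (twistOverK a b α x y t) 2}.ncard = 2 := by
  have hane := ha0.ne_zero
  have ha4 : ¬ 4 ∣ a := fun h => absurd (ha0 2 (by simpa using h)) (by decide)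
  have haF : ¬ IsFourPowMulOneMod a := by rwa [isFourPowMulOneMod_iff_of_not_dvd ha4]
  have hn0 : 8 * r * a ^ 2 * Y ^ 2 ≠ 0 := by positivity
  obtain ⟨N, hN⟩ := exists_not_four_pow_dvd hn0
  obtain ⟨w, c, hw, hwb⟩ := exists_sq_sub_eq_four_pow hb N
  -- If it vanished, aY² would be divisible by 4^N, against the choice of N.
  have hXw : X + Z * w ≠ 0 := by
    intro h0
    refine hN ⟨-(8 * r * a * c * Z ^ 2), ?_⟩
    linear_combination (-8 * r * a) * heqZ - (8 * r * a * Z ^ 2) * hwb +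
      8 * r * a * (X - Z * w) * h0
  refine ncard_eq_two_of_isFourPowMulOneMod (n := 2 * r * (X + Z * w)) (a := a)
    (mul_ne_zero (mul_ne_zero two_ne_zero hr) hXw) hane haF (fun t ht h => ?_)
    (fun t t' ht ht' => isFourPowMulOneMod_of_unramifiedOver_twistOverK hα hβ heq hxy hane
      (by omega) (by omega) (by omega))
  rcases h with h | h
  · exact unramifiedOver_twistOverK_of_split hα hβ heq hxy hane hb0 hb1 (by omega) hq hr hX hY heqZ
      hY0 hw hwb hN ht (.inl rfl) (by rwa [mul_one])
  · exact unramifiedOver_twistOverK_of_split hα hβ heq hxy hane hb0 hb1 (by omega) hq hr hX hY heqZ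
      hY0 hw hwb hN ht (.inr rfl) h

end QuadraticBase

end RedeiField

/-! ### Assembling the four parts. -/

open RedeiField in
theorem mainTheorem6 (a b : ℤ) (ha : Squarefree a) (hb : Squarefree b) (ha1 : a ≠ 1) (hb1 : b ≠ 1)
    (p : ℕ) (hp : p.Prime) (hpb : ¬ (p : ℤ) ∣ Δ b)
    (x y z : ℚ) (hxyz : (x, y, z) ≠ (0, 0, 0)) (hsol : x ^ 2 - a * y ^ 2 - b * z ^ 2 = 0)
    (α : ℂ) (hα : α ^ 2 = (a : ℂ)) :
    (¬ (p : ℤ) ∣ Δ a →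
      (p ≠ 2 → ∃! t : ℚ, t ∈ ({1, (p : ℚ)} : Set ℚ) ∧ UnramifiedOver ℚ (twist a b α x y t) p) ∧
      (p = 2 → ∃! t : ℚ, t ∈ ({1, -1, 2, -2} : Set ℚ) ∧
        UnramifiedOver ℚ (twist a b α x y t) p)) ∧
    (p ≠ 2 → (p : ℤ) ∣ Δ a →
      UnramifiedOver (sqrtField (a * b)) (extFieldOverK a b α x y) p) ∧
    (Even (Δ a) → Δ b ≡ 1 [ZMOD 8] →
      {t : ℚ | t ∈ ({1, -1, 2, -2} : Set ℚ) ∧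
        UnramifiedOver (sqrtField (a * b)) (twistOverK a b α x y t) 2}.ncard = 2) ∧
    (Even (Δ a) → Δ b ≡ 5 [ZMOD 8] →
      (∀ t : ℚ, t ≠ 0 →
        ¬ UnramifiedOver (sqrtField (a * b)) (twistOverK a b α x y t) 2) ∧
      Δ a ≡ 4 [ZMOD 8]) := by
  obtain ⟨β, hβ⟩ := exists_complex_sqrt (b : ℂ)
  have heq : x ^ 2 - a * y ^ 2 = b * z ^ 2 := by linear_combination hsol
  have hb0 : (b : ℚ) ≠ 0 := by exact_mod_cast hb.ne_zero
  have hxy0 : x ≠ 0 ∨ y ≠ 0 := by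
    by_contra! h
    obtain ⟨rfl, rfl⟩ := h
    have hz : b * z ^ 2 = 0 := by rw [← heq]; ring
    have hz0 : z = 0 := by simpa [hb0] using hz
    exact hxyz (by rw [hz0])
  have hxy : (x : ℂ) + y * α ≠ 0 := add_mul_sqrt_ne_zero ha ha1 hα hxy0
  -- If y = 0, then x² = bz² with x ≠ 0, making b a rational square.
  have hy0 : y ≠ 0 := by
    intro hy
    have hx0 : x ≠ 0 := by simpa [hy] using hxy0
    have h1 := add_mul_sqrt_ne_zero hb hb1 hβ (u := x) (v := z) (.inl hx0)
    have h2 := add_mul_sqrt_ne_zero hb hb1 hβ (u := x) (v := -z) (.inl hx0)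
    have h3 : (x : ℂ) ^ 2 = b * z ^ 2 := by
      rw [hy] at heq
      exact_mod_cast (by linear_combination heq : x ^ 2 = b * z ^ 2)
    refine mul_ne_zero h1 h2 ?_
    push_cast
    linear_combination h3 - z ^ 2 * hβ
  have hscale {s : ℕ} (hs : s.Prime) : ∃ (q : ℚ) (r X Y Z : ℤ), q ≠ 0 ∧ (r = 1 ∨ r = s) ∧ r ≠ 0 ∧
      x = q ^ 2 * r * X ∧ y = q ^ 2 * r * Y ∧ Y ≠ 0 ∧ X ^ 2 - a * Y ^ 2 = b * Z ^ 2 ∧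
      ¬ ((s : ℤ) ∣ X ∧ (s : ℤ) ∣ Y ∧ (s : ℤ) ∣ Z) := by
    obtain ⟨q, r, X, Y, Z, hq, hr, hX, hY, hZ, hprim⟩ := exists_primitive_multiple hs hxyz
    have hr0 : r ≠ 0 := by
      rcases hr with rfl | rfl
      exacts [one_ne_zero, by exact_mod_cast hs.ne_zero]
    refine ⟨q, r, X, Y, Z, hq, hr, hr0, hX, hY, ?_, ?_, hprim⟩
    · rintro rfl
      exact hy0 (by rw [hY]; simp)
    · have hr0' : (r : ℚ) ≠ 0 := by exact_mod_cast hr0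
      have h : (q ^ 2 * r) ^ 2 * ((X : ℚ) ^ 2 - a * Y ^ 2) = (q ^ 2 * r) ^ 2 * (b * Z ^ 2) := by
        rw [hX, hY, hZ] at heq
        linear_combination heq
      exact_mod_cast mul_left_cancel₀ (by positivity) h
  refine ⟨fun hpa => ⟨fun hp2 => ?_, ?_⟩, fun hp2 hpa => ?_, fun hΔa hΔb => ?_, fun hΔa hΔb => ?_⟩
  · rw [dvd_Δ_iff ha ha1 hp hp2] at hpa
    rw [dvd_Δ_iff hb hb1 hp hp2] at hpb
    obtain ⟨q, r, X, Y, Z, hq, hr, -, hX, hY, -, heqZ, hprim⟩ := hscale hp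
    have hr' : (r : ℚ) = 1 ∨ (r : ℚ) = p := by exact_mod_cast hr
    have hunr := exists_unramifiedOver_twist_of_odd hp hp2 hα hβ heq hxy hq hr hX hY heqZ hprim hpa
      hpb
    exact ⟨r, ⟨hr', hunr⟩, fun t ht =>
      eq_of_unramifiedOver_twist_of_odd hp hα heq hxy ht.1 hr' ht.2 hunr⟩
  · rintro rfl
    have ha4 := mod_four_eq_one_of_not_two_dvd ha ha1 hpa
    have hb4 := mod_four_eq_one_of_not_two_dvd hb hb1 hpb
    obtain ⟨q, r, X, Y, Z, hq, hr, -, hX, hY, -, heqZ, hprim⟩ := hscale Nat.prime_two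
    obtain ⟨t, ht, hunr⟩ := exists_unramifiedOver_twist_of_two hα hβ heq hxy hb hb1 hq hr hX hY heqZ
      hprim ha4 hb4
    refine ⟨t, ⟨by rcases ht with rfl | rfl | rfl | rfl <;> simp, hunr⟩, ?_⟩
    rintro t' ⟨ht', hunr'⟩
    obtain ⟨s, rfl, hs⟩ : ∃ s : ℤ, t' = s ∧ (s = 1 ∨ s = -1 ∨ s = 2 ∨ s = -2) := by
      rcases ht' with rfl | rfl | rfl | rfl
      exacts [⟨1, by simp⟩, ⟨-1, by simp⟩, ⟨2, by simp⟩, ⟨-2, by simp⟩]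
    rw [eq_of_unramifiedOver_twist_of_two hα heq hxy hs ht hunr' hunr]
  · rw [dvd_Δ_iff ha ha1 hp hp2] at hpa
    rw [dvd_Δ_iff hb hb1 hp hp2] at hpb
    obtain ⟨q, r, X, Y, Z, hq, hr, -, hX, hY, -, heqZ, hprim⟩ := hscale hp
    exact unramifiedOver_extFieldOverK_of_dvd hp hp2 hα hβ heq hxy hq hr hX hY heqZ hprim ha hpa hpb
  · obtain ⟨q, r, X, Y, Z, hq, -, hr, hX, hY, hY0, heqZ, -⟩ := hscale Nat.prime_two
    exact ncard_unramifiedOver_twistOverK hα hβ heq hxy ha (mod_four_ne_one_of_even ha ha1 hΔa) hb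
      hb1 (mod_eight_of_Δ hb hb1 rfl hΔb) hq hr hX hY heqZ hY0
  · obtain ⟨q, r, X, Y, Z, -, -, -, -, -, -, heqZ, hprim⟩ := hscale Nat.prime_two
    have ha4 := mod_four_ne_one_of_even ha ha1 hΔa
    have hb8 : b % 8 = 5 := mod_eight_of_Δ hb hb1 rfl hΔb
    have ha3 := mod_four_eq_three ha ha4 hb8 heqZ hprim
    refine ⟨fun t => not_unramifiedOver_twistOverK hα hβ heq hxy hy0 ha3 hb8, ?_⟩
    rw [Δ_of_mod_four_ne_one ha ha1 ha4, Int.ModEq]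
    omega
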